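/- Call a nondecreasing sequence $\Lambda=(\lambda_i)_{i\ge 1}$ of positive numbers with $\lambda_i\to\infty$ and $\sum_i 1/\lambda_i=\infty$ admissible. For such $\Lambda$ let $\Lambda BV$ be the class of all $2\pi$-periodic functions $f:\mathbb R\to\mathbb R$ with $$\sup\sum_i \frac{|f(I_i)|}{\lambda_i}<\infty ,\qquad f([a,b]):=f(b)-f(a),$$ the supremum being taken over all finite sequences $(I_i)$ of nonoverlapping subintervals of $[0,2\pi]$, and let $HBV$ be the class $\Lambda BV$ for $\lambda_i=i$. Functions in $\Lambda BV$ are bounded, and have one-sided limits $f(x\pm0)$ at every point $x$. For $g\in\Lambda BV$ with Fourier coefficients $a_k(g)=\frac1\pi\int_{-\pi}^{\pi}g(t)\cos kt\,dt$ and $b_k(g)=\frac1\pi\int_{-\pi}^{\pi}g(t)\sin kt\,dt$, let $$\tilde R_n(g,x)=\sum_{k=n}^{\infty}\bigl(a_k(g)\sin kx-b_k(g)\cos kx\bigr)$$ be the $n$-th order tail of the conjugate Fourier series of $g$, the sum being taken in $L^2(-\pi,\pi)$ and extended $2\pi$-periodically. For a $2\pi$-periodic function $f$ integrable on $[-\pi,\pi]$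 let $f^{(0)}=f$ and let $f^{(-m-1)}$ be the indefinite integral of $f^{(-m)}$ whose constant of integration is determined by $\int_{-\pi}^{\pi}f^{(-m-1)}(t)\,dt=0$ ($m=0,1,2,\dots$); $\tilde R_n^{(-m)}(g,\cdot)$ denotes $f^{(-m)}$ for $f=\tilde R_n(g,\cdot)$. (a) Let $g\in HBV$ and $r\in\{1,2,\dots\}$. Then at every point $x_0\in\mathbb R$ $$\lim_{n\to\infty} n^{2r}\,\tilde R_n^{(-2r)}(g,x_0)=\frac{(-1)^{r+1}}{2r\pi}\,\bigl[g(x_0+0)-g(x_0-0)\bigr].$$ (b) If $\Lambda$ is admissible and $\Lambda BV\supsetneqq HBV$, then assertion (a) does not hold on $\Lambda BV\setminus HBV$: there are a function $g\in\Lambda BV\setminus HBV$ and a point $x_0$ such that for no $r\in\{1,2,\dots\}$ does the limit relation in (a) hold for $g$, $r$ and $x_0$. -/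

import Mathlib

open Real Set Filter Topology MeasureTheory

noncomputable section

/-- An admissible sequence `Λ = (λ₁, λ₂, …)`: positive, nondecreasing, tending to infinity,
with `∑ 1 / λ_i` divergent. The term `λ_{i+1}` is `lam i`. -/
structure IsWatermanSeq (lam : ℕ → ℝ) : Prop where
  pos : ∀ i, 0 < lam i
  mono : Monotone lam
  tendsto : Tendsto lam atTop atTop
  diverges : ¬ Summable (fun i => 1 / lam i)

/-- The class `ΛBV`: the `2π`-periodic real functions of bounded `Λ`-variation on `[0, 2π]`,
i.e. the sums `∑ |f(I_i)| / λ_i`, with `f([a, b]) = f b - f a`, are bounded over all finite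
collections of nonoverlapping subintervals `I_i = [a i, b i]` of `[0, 2π]`, in any order. -/
def LambdaBV (lam : ℕ → ℝ) : Set (ℝ → ℝ) :=
  {f | Function.Periodic f (2 * π) ∧
    ∃ C : ℝ, ∀ (m : ℕ) (a b : Fin m → ℝ),
      (∀ i, 0 ≤ a i ∧ a i < b i ∧ b i ≤ 2 * π) →
      (∀ i j, i ≠ j → Disjoint (Ioo (a i) (b i)) (Ioo (a j) (b j))) →
      ∑ i, |f (b i) - f (a i)| / lam (i : ℕ) ≤ C}

/-- The class `HBV` of functions of harmonic bounded variation: `λ_i = i` for `i = 1, 2, …`. -/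
def HBV : Set (ℝ → ℝ) := LambdaBV (fun i => (i : ℝ) + 1)

/-- The cosine Fourier coefficient `a_k(g)`. -/
def cosCoeff (g : ℝ → ℝ) (k : ℕ) : ℝ := (1 / π) * ∫ t in (-π)..π, g t * Real.cos (k * t)

/-- The sine Fourier coefficient `b_k(g)`. -/
def sinCoeff (g : ℝ → ℝ) (k : ℕ) : ℝ := (1 / π) * ∫ t in (-π)..π, g t * Real.sin (k * t)

/-- The `k`-th term `a_k(g) sin kx - b_k(g) cos kx` of the conjugate Fourier series of `g`. -/
def conjTerm (g : ℝ → ℝ) (k : ℕ) (x : ℝ) : ℝ :=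
  cosCoeff g k * Real.sin (k * x) - sinCoeff g k * Real.cos (k * x)

/-- `R` is (a `2π`-periodic representative of) the `n`-th order tail `R̃_n(g, ·)`, the sum
`∑_{k ≥ n} (a_k(g) sin kx - b_k(g) cos kx)`, of the conjugate Fourier series of `g`. The sum is
taken in `L²(-π, π)`; it determines `R` up to equality almost everywhere. -/
def IsConjTail (g : ℝ → ℝ) (n : ℕ) (R : ℝ → ℝ) : Prop :=
  Function.Periodic R (2 * π) ∧
  MemLp R 2 (volume.restrict (Ioc (-π) π)) ∧
  Tendsto (fun N : ℕ => eLpNorm (fun x => (∑ k ∈ Finset.Ico n N, conjTerm g k x) - R x) 2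
    (volume.restrict (Ioc (-π) π))) atTop (𝓝 0)

/-- The indefinite integral of `f` whose constant of integration is fixed by the condition
that its integral over `[-π, π]` vanishes. -/
def zeroMeanPrimitive (f : ℝ → ℝ) (x : ℝ) : ℝ :=
  (∫ t in (0 : ℝ)..x, f t) - (1 / (2 * π)) * ∫ y in (-π)..π, ∫ t in (0 : ℝ)..y, f t

/-- The `m`-fold integral `f^{(-m)}`: `f^{(0)} = f` and `f^{(-m-1)} = ∫ f^{(-m)}`, each constant
of integration being fixed by the zero mean condition. -/
def iteratedPrimitive (m : ℕ) (f : ℝ → ℝ) : ℝ → ℝ := zeroMeanPrimitive^[m] f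

end

/-! Integrating twice multiplies the `k`-th harmonic by `-1/k^2`. Hence `n^(2r)` times the repeated
primitive of the tail at `x` is the limit, as `N → ∞`, of `(-1)^(r+1)/π · ∫_0^π (g(x+u) - g(x-u))
K(u) du`, where `K(u) = ∑_{n ≤ k < N} (n/k)^p sin ku` (`tailKernel`) and `p = 2r`.

For (a), `K` acts at scale `1/n` with mass tending to `1/p`, and this produces the jump. Summation
by parts gives `|K(t)| ≤ π/t`, and an antiderivative of `K` is at most `π/(nt)`; there is no better
absolute decay, so `∫|K|` is of logarithmic size in general. Bounded harmonic variation is what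
compensates. On the grid of mesh `π/n` the error is about `∑ |φ(I_i)|/i`
(`abs_integral_mul_tailKernel_le`), where `φ` is `g` on one side of `x` minus its one-sided limit.
Near the point the sum is small because the harmonic variation of `φ` shrinks there
(`LamVarLE.exists_harmonic_le`). Far from it the weights are `O(1/n)`, and averaging over cyclic
permutations of the weights makes the sum `O(1/log n)` (`LamVarLE.sum_mul_harmonic_le`).

For (b), if `ΛBV` is not contained in `HBV`, then `∑_{i ≤ N} 1/i` is not `O(∑_{i ≤ N} 1/λ_i)`
(`lambdaBV_subset_HBV`). A cosine wave with `N` half-periods on one side of `0` has `Λ`-variation at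
most a constant times `∑_{i ≤ N} 1/λ_i` (`sum_abs_cosWave_le`), yet its pairing with the kernel it
resonates with is at least `(∑_{i ≤ N} 1/i)/3 - O(1)` (`le_integral_cosWave`). The normalised waves
have `ℓ¹` superpositions in `ΛBV`, and a Baire category argument finds one superposition whose
pairings are unbounded for every `r` at once (`exists_unbounded_tails`). Convergence of the scaled
tails to any limit would bound these pairings (`exists_abs_integral_tailKernel_le`). The same
function lies outside `HBV`, since otherwise (a) would apply to it. -/

/-! ### `Λ`-variation with freely distributed weights -/

/-- The `Λ`-variation of `f` on `S` is at most `C`; the weights may be distributed in any way. -/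
def LamVarLE (lam : ℕ → ℝ) (f : ℝ → ℝ) (S : Set ℝ) (C : ℝ) : Prop :=
  ∀ (ι : Type) (s : Finset ι) (a b : ι → ℝ) (e : ι → ℕ), Set.InjOn e s →
    (∀ i ∈ s, a i ∈ S ∧ b i ∈ S ∧ a i ≤ b i) →
    (∀ i ∈ s, ∀ j ∈ s, i ≠ j → Disjoint (Ioo (a i) (b i)) (Ioo (a j) (b j))) →
    ∑ i ∈ s, |f (b i) - f (a i)| / lam (e i) ≤ C

lemma Fin.val_le_of_strictMono {m : ℕ} {f : Fin m → ℕ} (hf : StrictMono f) (k : Fin m) :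
    (k : ℕ) ≤ f k := by
  obtain ⟨k, hk⟩ := k
  induction k with
  | zero => simp
  | succ k ih =>
    have h1 := ih (by omega)
    have h2 : f ⟨k, by omega⟩ < f ⟨k + 1, hk⟩ := hf (by simp [Fin.lt_def])
    simp only at h1 ⊢
    omega

/-- List the intervals by increasing weight index: the `k`-th index is then at least `k`, so
monotonicity of `lam` only decreases each term. Degenerate intervals, excluded in `LambdaBV`,
contribute nothing. Free index types and injective weight assignments make it possible to merge
families and permute weights later. -/
lemma exists_lamVarLE_of_mem {lam : ℕ → ℝ} (hpos : ∀ i, 0 < lam i) (hmono : Monotone lam)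
    {f : ℝ → ℝ} (hf : f ∈ LambdaBV lam) : ∃ C, LamVarLE lam f (Icc 0 (2 * π)) C := by
  classical
  obtain ⟨-, C, hC⟩ := hf
  refine ⟨C, fun ι s a b e he h hd => ?_⟩
  set t := s.filter (fun i => a i < b i) with ht
  have hst : ∑ i ∈ s, |f (b i) - f (a i)| / lam (e i)
      = ∑ i ∈ t, |f (b i) - f (a i)| / lam (e i) := by
    rw [ht, Finset.sum_filter_of_ne]
    intro i hi hne
    refine lt_of_le_of_ne (h i hi).2.2 fun hab => hne ?_
    simp [hab]
  have hts : ∀ i ∈ t, i ∈ s ∧ a i < b i := fun i hi => by simpa [ht] using hi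
  set T := t.image e with hT
  have hemb : ∀ k : Fin T.card, ∃ i ∈ t, e i = T.orderEmbOfFin rfl k := fun k => by
    exact Finset.mem_image.1 (T.orderEmbOfFin_mem rfl k)
  choose i hit hie using hemb
  have hinj : ∀ k l, i k = i l → k = l := fun k l hkl => by
    have : T.orderEmbOfFin rfl k = T.orderEmbOfFin rfl l := by rw [← hie, ← hie, hkl]
    exact (T.orderEmbOfFin rfl).injective this
  have hsum : ∑ j ∈ t, |f (b j) - f (a j)| / lam (e j)
      = ∑ k : Fin T.card, |f (b (i k)) - f (a (i k))| / lam (e (i k)) := by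
    symm
    refine Finset.sum_bij (fun k _ => i k) (fun k _ => hit k) (fun k _ l _ => hinj k l) ?_
      (fun _ _ => rfl)
    intro j hj
    have hjT : e j ∈ Set.range (T.orderEmbOfFin rfl) := by
      rw [Finset.range_orderEmbOfFin]
      exact_mod_cast Finset.mem_image_of_mem e hj
    obtain ⟨k, hk⟩ := hjT
    exact ⟨k, Finset.mem_univ _, he (hts _ (hit k)).1 (hts _ hj).1 ((hie k).trans hk)⟩
  rw [hst, hsum]
  refine le_trans (Finset.sum_le_sum fun k _ => ?_) (hC T.card (a ∘ i) (b ∘ i) ?_ ?_)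
  · refine div_le_div_of_nonneg_left (abs_nonneg _) (hpos _) (hmono ?_)
    rw [hie]
    exact Fin.val_le_of_strictMono (T.orderEmbOfFin rfl).strictMono k
  · intro k
    have h1 := hts _ (hit k)
    have h2 := h _ h1.1
    exact ⟨h2.1.1, h1.2, h2.2.1.2⟩
  · intro k l hkl
    exact hd _ (hts _ (hit k)).1 _ (hts _ (hit l)).1 fun h => hkl (hinj k l h)

namespace LamVarLE

variable {lam : ℕ → ℝ} {f : ℝ → ℝ} {S : Set ℝ} {C : ℝ}

lemma mono_set {T : Set ℝ} (h : LamVarLE lam f S C) (hTS : T ⊆ S) : LamVarLE lam f T C :=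
  fun ι s a b e he hs hd =>
    h ι s a b e he (fun i hi => ⟨hTS (hs i hi).1, hTS (hs i hi).2.1, (hs i hi).2.2⟩) hd

lemma sub_const (h : LamVarLE lam f S C) (d : ℝ) : LamVarLE lam (fun x => f x - d) S C :=
  fun ι s a b e he hs hd => by simpa using h ι s a b e he hs hd

lemma comp_add (h : LamVarLE lam f S C) (d : ℝ) :
    LamVarLE lam (fun x => f (x + d)) {x | x + d ∈ S} C := by
  intro ι s a b e he hs hd
  refine h ι s (fun i => a i + d) (fun i => b i + d) e he
    (fun i hi => ⟨(hs i hi).1, (hs i hi).2.1, by simpa using (hs i hi).2.2⟩) ?_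
  intro i hi j hj hij
  have := hd i hi j hj hij
  rw [Set.disjoint_left] at this ⊢
  intro x hx hx'
  refine @this (x - d) ?_ ?_ <;> constructor <;> linarith [hx.1, hx.2, hx'.1, hx'.2]

lemma comp_neg (h : LamVarLE lam f S C) : LamVarLE lam (fun x => f (-x)) {x | -x ∈ S} C := by
  intro ι s a b e he hs hd
  have := h ι s (fun i => -b i) (fun i => -a i) e he
    (fun i hi => ⟨(hs i hi).2.1, (hs i hi).1, by simpa using (hs i hi).2.2⟩) ?_
  · simpa [abs_sub_comm] using this
  intro i hi j hj hij
  have := hd i hi j hj hij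
  rw [Set.disjoint_left] at this ⊢
  intro x hx hx'
  refine @this (-x) ?_ ?_ <;> constructor <;> linarith [hx.1, hx.2, hx'.1, hx'.2]

lemma abs_sub_le (hpos : ∀ i, 0 < lam i) (h : LamVarLE lam f S C) {x y : ℝ} (hx : x ∈ S)
    (hy : y ∈ S) : |f y - f x| ≤ C * lam 0 := by
  wlog hxy : x ≤ y generalizing x y
  · rw [abs_sub_comm]
    exact this hy hx (le_of_not_ge hxy)
  have := h Unit Finset.univ (fun _ => x) (fun _ => y) (fun _ => 0)
    (fun _ _ _ _ _ => Subsingleton.elim _ _) (fun _ _ => ⟨hx, hy, hxy⟩)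
    (fun i _ j _ hij => (hij (Subsingleton.elim _ _)).elim)
  simp only [Finset.univ_unique, Finset.sum_const, Finset.card_singleton, one_smul] at this
  rwa [div_le_iff₀ (hpos 0)] at this

/-- Boundedness of the variation on one period carries over to every period. -/
lemma exists_shift (hpos : ∀ i, 0 < lam i) (hmono : Monotone lam)
    (hper : Function.Periodic f (2 * π)) (h : LamVarLE lam f (Icc 0 (2 * π)) C) (c : ℝ) :
    ∃ C', LamVarLE lam f (Icc c (c + 2 * π)) C' := by
  classical
  have h2 : (0 : ℝ) < 2 * π := by positivity
  have hshift : ∀ k : ℤ, ∀ S : Set ℝ, (∀ x ∈ S, x + k * (2 * π) ∈ Icc 0 (2 * π)) →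
      LamVarLE lam f S C := by
    intro k S hS
    have h1 := h.comp_add (k * (2 * π))
    have h3 : (fun x => f (x + k * (2 * π))) = f := by
      funext x
      have := hper.int_mul k x
      simpa using this
    rw [h3] at h1
    exact h1.mono_set hS
  obtain ⟨k, hk, -⟩ := existsUnique_add_zsmul_mem_Ico h2 c 0
  simp only [zsmul_eq_mul, zero_add] at hk
  have hbd : ∀ x y, |f y - f x| ≤ C * lam 0 := by
    intro x y
    obtain ⟨x', hx', hxx⟩ := hper.exists_mem_Ico₀ h2 x
    obtain ⟨y', hy', hyy⟩ := hper.exists_mem_Ico₀ h2 y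
    rw [hxx, hyy]
    exact h.abs_sub_le hpos (Ico_subset_Icc_self hx') (Ico_subset_Icc_self hy')
  -- `p` is the multiple of `2π` lying in `(c, c + 2π]`. It cuts the window into two pieces, each a
  -- translate of a part of `[0, 2π]`.
  set p : ℝ := 2 * π - k * (2 * π) with hp
  have hL : LamVarLE lam f (Icc c p) C := hshift k _ fun x hx => by
    constructor
    · linarith [hx.1, hk.1]
    · have := hx.2; rw [hp] at this; linarith
  have hR : LamVarLE lam f (Icc p (c + 2 * π)) C := hshift (k - 1) _ fun x hx => by
    push_cast
    have h1 := hx.1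
    have h2 := hx.2
    rw [hp] at h1
    constructor
    · linarith
    · linarith [hk.2]
  refine ⟨C + C + C, fun ι s a b e he hs hd => ?_⟩
  rw [← Finset.sum_filter_add_sum_filter_not s (fun i => b i ≤ p),
    ← Finset.sum_filter_add_sum_filter_not (s.filter fun i => ¬ b i ≤ p) (fun i => p ≤ a i),
    ← add_assoc]
  gcongr ?_ + ?_ + ?_
  · refine hL ι _ a b e (he.mono (Finset.coe_subset.2 (Finset.filter_subset _ _))) (fun i hi => ?_)
      fun i hi j hj => hd i (Finset.mem_filter.1 hi).1 j (Finset.mem_filter.1 hj).1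
    rw [Finset.mem_filter] at hi
    have := hs i hi.1
    exact ⟨⟨this.1.1, this.2.2.trans hi.2⟩, ⟨this.2.1.1, hi.2⟩, this.2.2⟩
  · refine hR ι _ a b e (he.mono fun i hi => ?_) (fun i hi => ?_)
      fun i hi j hj => hd i ?_ j ?_
    · simp only [Finset.coe_filter, Finset.mem_filter, Set.mem_ofPred_eq] at hi
      exact hi.1.1
    · simp only [Finset.mem_filter] at hi
      have := hs i hi.1.1
      exact ⟨⟨hi.2, this.1.2⟩, ⟨hi.2.trans this.2.2, this.2.1.2⟩, this.2.2⟩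
    · simp only [Finset.mem_filter] at hi; exact hi.1.1
    · simp only [Finset.mem_filter] at hj; exact hj.1.1
  -- These intervals contain `p` in their interior, so disjointness leaves at most one. The
  -- oscillation bound controls it by the third `C`.
  · set u := (s.filter fun i => ¬ b i ≤ p).filter fun i => ¬ p ≤ a i with hu
    have hmem : ∀ i ∈ u, i ∈ s ∧ p < b i ∧ a i < p := fun i hi => by
      simp only [hu, Finset.mem_filter, not_le] at hi
      exact ⟨hi.1.1, hi.1.2, hi.2⟩
    have hcard : u.card ≤ 1 := by
      rw [Finset.card_le_one]
      intro i hi j hj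
      by_contra hij
      obtain ⟨his, hi1, hi2⟩ := hmem i hi
      obtain ⟨hjs, hj1, hj2⟩ := hmem j hj
      exact (Set.disjoint_left.1 (hd i his j hjs hij)) ⟨hi2, hi1⟩ ⟨hj2, hj1⟩
    have hC : 0 ≤ C := by
      have := hbd 0 0
      simp only [sub_self, abs_zero] at this
      exact nonneg_of_mul_nonneg_left this (hpos 0)
    calc ∑ i ∈ u, |f (b i) - f (a i)| / lam (e i) ≤ ∑ i ∈ u, C := by
          refine Finset.sum_le_sum fun i _ => ?_
          rw [div_le_iff₀ (hpos _)]
          exact (hbd _ _).trans (mul_le_mul_of_nonneg_left (hmono (Nat.zero_le _)) hC)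
      _ = u.card * C := by simp
      _ ≤ 1 * C := by gcongr; exact_mod_cast hcard
      _ = C := one_mul C

/-- One-sided limits. -/
lemma exists_tendsto_right (hpos : ∀ i, 0 < lam i) (hdiv : ¬ Summable fun i => 1 / lam i)
    {x y : ℝ} (hxy : x < y) (h : LamVarLE lam f (Ioo x y) C) :
    ∃ l, Tendsto f (𝓝[>] x) (𝓝 l) := by
  have hcauchy : Cauchy (map f (𝓝[>] x)) := by
    rw [Metric.cauchy_iff]
    refine ⟨inferInstance, fun ε hε => ?_⟩
    by_contra! hcon
    have key : ∀ δ, x < δ → ∃ p : ℝ × ℝ, x < p.1 ∧ p.1 ≤ p.2 ∧ p.2 < δ ∧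
        ε ≤ |f p.2 - f p.1| := by
      intro δ hδ
      obtain ⟨u, hu, v, hv, huv⟩ := hcon (f '' Ioo x δ)
        (image_mem_map (Ioo_mem_nhdsGT hδ))
      obtain ⟨u', hu', rfl⟩ := hu
      obtain ⟨v', hv', rfl⟩ := hv
      rw [Real.dist_eq] at huv
      rcases le_total u' v' with hle | hle
      · exact ⟨(u', v'), hu'.1, hle, hv'.2, by rwa [abs_sub_comm] at huv⟩
      · exact ⟨(v', u'), hv'.1, hle, hu'.2, huv⟩
    -- The intervals march towards `x`, each to the left of all former ones, with increments at
    -- least `ε`. The divergence of `∑ 1/λ_i` then contradicts the bound on the variation.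
    obtain ⟨q, hq⟩ := exists_seq_of_forall_finset_exists
      (fun p : ℝ × ℝ => x < p.1 ∧ p.1 ≤ p.2 ∧ p.2 < y ∧ ε ≤ |f p.2 - f p.1|)
      (fun p p' => p'.2 ≤ p.1) (by
        intro s hs
        have : ∃ δ, x < δ ∧ δ ≤ y ∧ ∀ p ∈ s, δ ≤ p.1 := by
          clear hcon key
          classical
          induction s using Finset.induction_on with
          | empty => exact ⟨y, hxy, le_rfl, by simp⟩
          | insert p s hps ih =>
            obtain ⟨δ, h1, h2, h3⟩ := ih fun z hz => hs z (Finset.mem_insert_of_mem hz)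
            refine ⟨min δ p.1, lt_min h1 (hs p (Finset.mem_insert_self _ _)).1,
              (min_le_left _ _).trans h2, fun z hz => ?_⟩
            rcases Finset.mem_insert.1 hz with rfl | hz
            · exact min_le_right _ _
            · exact (min_le_left _ _).trans (h3 z hz)
        obtain ⟨δ, h1, h2, h3⟩ := this
        obtain ⟨p, hp1, hp2, hp3, hp4⟩ := key δ h1
        exact ⟨p, ⟨hp1, hp2, hp3.trans_le h2, hp4⟩, fun z hz => hp3.le.trans (h3 z hz)⟩)
    refine hdiv (summable_of_sum_range_le (c := C / ε) (fun i => (one_div_pos.2 (hpos i)).le)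
      fun n => ?_)
    have := h ℕ (Finset.range n) (fun i => (q i).1) (fun i => (q i).2) id (injOn_id _)
      (fun i _ => ?_) (fun i _ j _ hij => ?_)
    · rw [le_div_iff₀ hε]
      refine le_trans ?_ this
      rw [Finset.sum_mul]
      refine Finset.sum_le_sum fun i _ => ?_
      rw [div_mul_eq_mul_div, one_mul]
      exact div_le_div_of_nonneg_right (hq.1 i).2.2.2 (hpos i).le
    · obtain ⟨h1, h2, h3, -⟩ := hq.1 i
      exact ⟨⟨h1, h2.trans_lt h3⟩, ⟨h1.trans_le h2, h3⟩, h2⟩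
    · rw [Set.disjoint_left]
      intro z hz hz'
      rcases lt_or_gt_of_ne hij with hlt | hlt
      · linarith [hq.2 i j hlt, hz.1, hz'.2]
      · linarith [hq.2 j i hlt, hz.2, hz'.1]
  exact CompleteSpace.complete hcauchy

lemma exists_tendsto_left (hpos : ∀ i, 0 < lam i) (hdiv : ¬ Summable fun i => 1 / lam i)
    {x y : ℝ} (hxy : y < x) (h : LamVarLE lam f (Ioo y x) C) :
    ∃ l, Tendsto f (𝓝[<] x) (𝓝 l) := by
  obtain ⟨l, hl⟩ := exists_tendsto_right (f := fun t => f (-t)) hpos hdiv (neg_lt_neg hxy)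
    (h.comp_neg.mono_set fun t ht => ⟨by linarith [ht.2], by linarith [ht.1]⟩)
  refine ⟨l, ?_⟩
  have := hl.comp (tendsto_neg_nhdsLT (a := x))
  simpa [Function.comp_def] using this

end LamVarLE

/-! ### Localisation and averaging of the harmonic variation -/

/-- The harmonic variation near a one-sided zero is small near that point. -/
lemma LamVarLE.exists_harmonic_le {φ : ℝ → ℝ} {C d : ℝ} (hd : 0 < d)
    (h : LamVarLE (fun i => (i : ℝ) + 1) φ (Ioc 0 d) C) (h0 : Tendsto φ (𝓝[>] 0) (𝓝 0))
    {ε : ℝ} (hε : 0 < ε) :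
    ∃ δ, 0 < δ ∧ δ ≤ d ∧ LamVarLE (fun i => (i : ℝ) + 1) φ (Ioc 0 δ) ε := by
  classical
  by_contra! hcon
  -- If every neighbourhood carries harmonic variation above `ε`, stacking families ever closer to
  -- `0` gains `ε/4` each time, which eventually exceeds `C`.
  have key : ∀ k : ℕ, ∀ δ, 0 < δ → δ ≤ d →
      ∃ (ι : Type) (s : Finset ι) (a b : ι → ℝ) (e : ι → ℕ), Set.InjOn e s ∧
      (∀ i ∈ s, a i ∈ Ioc 0 δ ∧ b i ∈ Ioc 0 δ ∧ a i ≤ b i) ∧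
      (∀ i ∈ s, ∀ j ∈ s, i ≠ j → Disjoint (Ioo (a i) (b i)) (Ioo (a j) (b j))) ∧
      k * (ε / 4) ≤ ∑ i ∈ s, |φ (b i) - φ (a i)| / ((e i : ℝ) + 1) := by
    intro k
    induction k with
    | zero =>
      intro δ _ _
      exact ⟨Empty, ∅, fun _ => 0, fun _ => 0, fun _ => 0, by simp, by simp, by simp, by simp⟩
    | succ k ih =>
      intro δ hδ hδd
      obtain ⟨ι, s, a, b, e, he, hs, hdis, hsum⟩ := ih δ hδ hδd
      set N := s.sup e + 1 with hN
      have heN : ∀ i ∈ s, e i < N := fun i hi => Nat.lt_succ_of_le (Finset.le_sup (f := e) hi)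
      set η := ε / (4 * N) with hη
      have hNpos : (0 : ℝ) < N := by rw [hN]; positivity
      have hηpos : 0 < η := by positivity
      have hev : ∀ᶠ t in 𝓝[>] (0 : ℝ), |φ t| < η := by
        have := h0.abs
        rw [abs_zero] at this
        exact this.eventually (gt_mem_nhds hηpos)
      obtain ⟨δ₁, hδ₁, hδ₁'⟩ := (mem_nhdsGT_iff_exists_Ioc_subset).1 hev
      have : ∃ δ₂, 0 < δ₂ ∧ δ₂ ≤ min δ δ₁ ∧ ∀ i ∈ s, δ₂ ≤ a i := by
        rcases s.eq_empty_or_nonempty with rfl | hne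
        · exact ⟨min δ δ₁, lt_min hδ hδ₁, le_rfl, by simp⟩
        · obtain ⟨i, hi, hmin⟩ := s.exists_min_image a hne
          refine ⟨min (min δ δ₁) (a i), lt_min (lt_min hδ hδ₁) (hs i hi).1.1, min_le_left _ _,
            fun j hj => (min_le_right _ _).trans (hmin j hj)⟩
      obtain ⟨δ₂, hδ₂, hδ₂δ, hδ₂a⟩ := this
      have hc := hcon δ₂ hδ₂ ((hδ₂δ.trans (min_le_left _ _)).trans hδd)
      unfold LamVarLE at hc
      push Not at hc
      obtain ⟨κ, s', a', b', e', he', hs', hdis', hsum'⟩ := hc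
      refine ⟨ι ⊕ κ, s.disjSum s', Sum.elim a a', Sum.elim b b',
        Sum.elim e (fun j => e' j + N), ?_, ?_, ?_, ?_⟩
      · rintro (i | i) hi (j | j) hj hij
        · simp only [Finset.mem_coe, Finset.inl_mem_disjSum] at hi hj
          simp only [Sum.elim_inl] at hij
          rw [he hi hj hij]
        · simp only [Finset.mem_coe, Finset.inl_mem_disjSum] at hi
          have := heN i hi
          simp only [Sum.elim_inl, Sum.elim_inr] at hij
          omega
        · simp only [Finset.mem_coe, Finset.inl_mem_disjSum] at hj
          have := heN j hj
          simp only [Sum.elim_inl, Sum.elim_inr] at hij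
          omega
        · simp only [Finset.mem_coe, Finset.inr_mem_disjSum] at hi hj
          simp only [Sum.elim_inr] at hij
          rw [he' hi hj (by omega)]
      · rintro (i | i) hi
        · simp only [Finset.inl_mem_disjSum] at hi
          exact hs i hi
        · simp only [Finset.inr_mem_disjSum] at hi
          obtain ⟨h1, h2, h3⟩ := hs' i hi
          have h4 := hδ₂δ.trans (min_le_left _ _)
          exact ⟨⟨h1.1, h1.2.trans h4⟩, ⟨h2.1, h2.2.trans h4⟩, h3⟩
      · rintro (i | i) hi (j | j) hj hij
        · simp only [Finset.inl_mem_disjSum] at hi hj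
          exact hdis i hi j hj fun h => hij (by rw [h])
        · simp only [Finset.inl_mem_disjSum, Finset.inr_mem_disjSum] at hi hj
          rw [Set.disjoint_left]
          intro z hz hz'
          simp only [Sum.elim_inl, Sum.elim_inr] at hz hz'
          linarith [hz.1, hz'.2, (hs' j hj).2.1.2, hδ₂a i hi]
        · simp only [Finset.inl_mem_disjSum, Finset.inr_mem_disjSum] at hi hj
          rw [Set.disjoint_left]
          intro z hz hz'
          simp only [Sum.elim_inl, Sum.elim_inr] at hz hz'
          linarith [hz'.1, hz.2, (hs' i hi).2.1.2, hδ₂a j hj]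
        · simp only [Finset.inr_mem_disjSum] at hi hj
          exact hdis' i hi j hj fun h => hij (by rw [h])
      · rw [Finset.sum_disjSum]
        simp only [Sum.elim_inl, Sum.elim_inr]
        have hsmall : ∀ j ∈ s', |φ (b' j) - φ (a' j)| ≤ 2 * η := by
          intro j hj
          obtain ⟨h1, h2, -⟩ := hs' j hj
          have h4 := hδ₂δ.trans (min_le_right _ _)
          have h5 : |φ (a' j)| < η := hδ₁' ⟨h1.1, h1.2.trans h4⟩
          have h6 : |φ (b' j)| < η := hδ₁' ⟨h2.1, h2.2.trans h4⟩
          linarith [abs_sub (φ (b' j)) (φ (a' j))]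
        have hlow : ∀ j ∈ s', |φ (b' j) - φ (a' j)| / ((e' j : ℝ) + 1) / 2
            - (if e' j < N then η else 0)
            ≤ |φ (b' j) - φ (a' j)| / (((e' j + N : ℕ) : ℝ) + 1) := by
          intro j hj
          have hx := hsmall j hj
          set X := |φ (b' j) - φ (a' j)|
          have hX : 0 ≤ X := abs_nonneg _
          have he0 : (0 : ℝ) ≤ e' j := Nat.cast_nonneg _
          split_ifs with hlt
          · have h1 : X / ((e' j : ℝ) + 1) ≤ X := div_le_self hX (by linarith)
            have h2 : 0 ≤ X / (((e' j + N : ℕ) : ℝ) + 1) := by positivity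
            linarith
          · rw [div_div, sub_zero]
            have : (N : ℝ) ≤ e' j := by exact_mod_cast not_lt.1 hlt
            refine div_le_div_of_nonneg_left hX (by positivity) ?_
            push_cast
            linarith
        have hcnt : ∑ j ∈ s', (if e' j < N then η else 0) ≤ N * η := by
          rw [← Finset.sum_filter, Finset.sum_const, nsmul_eq_mul]
          refine mul_le_mul_of_nonneg_right ?_ hηpos.le
          have : (s'.filter fun j => e' j < N).card ≤ (Finset.range N).card :=
            Finset.card_le_card_of_injOn e' (fun j hj => by
              have := (Finset.mem_filter.1 hj).2
              simpa using this) (he'.mono (Finset.coe_subset.2 (Finset.filter_subset _ _)))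
          rw [Finset.card_range] at this
          exact_mod_cast this
        have hNη : N * η = ε / 4 := by rw [hη]; field_simp
        have := Finset.sum_le_sum hlow
        rw [Finset.sum_sub_distrib, ← Finset.sum_div] at this
        push_cast at this ⊢
        linarith
  obtain ⟨k, hk⟩ := exists_nat_gt (C / (ε / 4))
  obtain ⟨ι, s, a, b, e, he, hs, hdis, hsum⟩ := key k d hd le_rfl
  have := h ι s a b e he hs hdis
  rw [div_lt_iff₀ (by positivity)] at hk
  linarith

/-- The increments of a function of bounded harmonic variation are small on average. -/
lemma LamVarLE.sum_mul_harmonic_le {f : ℝ → ℝ} {S : Set ℝ} {C : ℝ}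
    (h : LamVarLE (fun i => (i : ℝ) + 1) f S C) (m : ℕ) (a b : ℕ → ℝ)
    (hs : ∀ i < m, a i ∈ S ∧ b i ∈ S ∧ a i ≤ b i)
    (hd : ∀ i < m, ∀ j < m, i ≠ j → Disjoint (Ioo (a i) (b i)) (Ioo (a j) (b j))) :
    (∑ i ∈ Finset.range m, |f (b i) - f (a i)|) * ∑ j ∈ Finset.range m, 1 / ((j : ℝ) + 1)
      ≤ m * C := by
  rcases m with - | m
  · simp
  rw [← Fin.sum_univ_eq_sum_range (fun i => |f (b i) - f (a i)|),
    ← Fin.sum_univ_eq_sum_range (fun j => 1 / ((j : ℝ) + 1))]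
  -- Addition in `Fin (m + 1)` is cyclic, so every shift by `j` is a permutation of the weights.
  -- Over all `j` each increment meets each weight exactly once.
  have key : ∀ j : Fin (m + 1),
      ∑ i : Fin (m + 1), |f (b i) - f (a i)| / (((i + j : Fin (m + 1)) : ℕ) + 1 : ℝ) ≤ C := by
    intro j
    refine h (Fin (m + 1)) Finset.univ (fun i => a i) (fun i => b i)
      (fun i => ((i + j : Fin (m + 1)) : ℕ)) ?_ (fun i _ => hs i i.2) fun i _ k _ hik =>
        hd i i.2 k k.2 fun h => hik (Fin.ext h)
    intro i _ k _ hik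
    exact add_right_cancel (Fin.ext hik)
  calc _ = ∑ j : Fin (m + 1), ∑ i : Fin (m + 1),
        |f (b i) - f (a i)| / (((i + j : Fin (m + 1)) : ℕ) + 1 : ℝ) := by
        rw [Finset.sum_comm, Finset.sum_mul]
        refine Finset.sum_congr rfl fun i _ => ?_
        rw [← Equiv.sum_comp (Equiv.addLeft i) (fun j : Fin (m + 1) => 1 / ((j : ℕ) + 1 : ℝ)),
          Finset.mul_sum]
        refine Finset.sum_congr rfl fun j _ => ?_
        simp only [Equiv.coe_addLeft]
        ring
    _ ≤ ∑ j : Fin (m + 1), C := Finset.sum_le_sum fun j _ => key j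
    _ = _ := by simp

/-! ### Measurability from one-sided limits -/

/-- On each side of `y` the values of `f` stay within `ε/2` of the one-sided limit at `y`, and the
left limits at nearby points inherit this. Thus the points where `f` differs from its left limit by
at least `ε` are isolated. -/
lemma eventually_abs_sub_leftLimit_lt {f L : ℝ → ℝ} (hL : ∀ x, Tendsto f (𝓝[<] x) (𝓝 (L x)))
    (hr : ∀ x, ∃ l, Tendsto f (𝓝[>] x) (𝓝 l)) {ε : ℝ} (hε : 0 < ε) (y : ℝ) :
    ∀ᶠ x in 𝓝[≠] y, |f x - L x| < ε := by
  rw [← Iio_union_Ioi, nhdsWithin_union, eventually_sup]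
  have key : ∀ l x : ℝ, ∀ s ∈ 𝓝[<] x, |f x - l| < ε / 2 → (∀ z ∈ s, |f z - l| < ε / 2) →
      |f x - L x| < ε := by
    intro l x s hs hx hz
    have h1 : |L x - l| ≤ ε / 2 :=
      le_of_tendsto ((hL x).sub_const l).abs (by filter_upwards [hs] with z hzs using (hz z hzs).le)
    have := abs_sub_le (f x) l (L x)
    rw [abs_sub_comm l] at this
    linarith
  constructor
  · have := ((hL y).sub_const (L y)).abs
    rw [sub_self, abs_zero] at this
    obtain ⟨z, hz, hzs⟩ := (mem_nhdsLT_iff_exists_Ioo_subset).1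
      (this.eventually (gt_mem_nhds (half_pos hε)))
    filter_upwards [Ioo_mem_nhdsLT hz] with x hx
    exact key (L y) x (Ioo z x) (Ioo_mem_nhdsLT hx.1) (hzs hx)
      fun t ht => hzs ⟨ht.1, ht.2.trans hx.2⟩
  · obtain ⟨l, hl⟩ := hr y
    have := (hl.sub_const l).abs
    rw [sub_self, abs_zero] at this
    obtain ⟨z, hz, hzs⟩ := (mem_nhdsGT_iff_exists_Ioo_subset).1
      (this.eventually (gt_mem_nhds (half_pos hε)))
    filter_upwards [Ioo_mem_nhdsGT hz] with x hx
    exact key l x (Ioo y x) (Ioo_mem_nhdsLT hx.1) (hzs hx)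
      fun t ht => hzs ⟨ht.1, ht.2.trans hx.2⟩

/-- A function with one-sided limits everywhere is almost everywhere measurable. -/
lemma aemeasurable_of_oneSided_limits {f : ℝ → ℝ} (hl : ∀ x, ∃ l, Tendsto f (𝓝[<] x) (𝓝 l))
    (hr : ∀ x, ∃ l, Tendsto f (𝓝[>] x) (𝓝 l)) : AEMeasurable f volume := by
  choose L hL using hl
  have hmeas : Measurable L := by
    -- The left limit is the pointwise limit of `f` sampled at the last point of the grid of mesh
    -- `1/(n+1)` strictly before `x`. The sample depends on an integer only and is therefore
    -- measurable whatever `f` is.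
    refine measurable_of_tendsto_metrizable
      (f := fun (n : ℕ) x => f (((⌈x * ((n : ℝ) + 1)⌉ - 1 : ℤ) : ℝ) / ((n : ℝ) + 1))) (fun n => ?_) ?_
    · have : Measurable fun x : ℝ => ⌈x * ((n : ℝ) + 1)⌉ := Int.measurable_ceil.comp (by fun_prop)
      exact (measurable_from_top (f := fun k : ℤ => f (((k - 1 : ℤ) : ℝ) / ((n : ℝ) + 1)))).comp this
    · rw [tendsto_pi_nhds]
      intro x
      refine (hL x).comp (tendsto_nhdsWithin_iff.2 ⟨?_, Eventually.of_forall fun n => ?_⟩)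
      · refine tendsto_of_tendsto_of_tendsto_of_le_of_le
          (g := fun n : ℕ => x - 1 / ((n : ℝ) + 1)) (h := fun _ => x) ?_ tendsto_const_nhds ?_ ?_
        · simpa using tendsto_const_nhds.sub (tendsto_one_div_add_atTop_nhds_zero_nat (𝕜 := ℝ))
        · intro n
          have hn : (0 : ℝ) < n + 1 := by positivity
          simp only
          rw [le_div_iff₀ hn, sub_mul, one_div, inv_mul_cancel₀ hn.ne']
          push_cast
          linarith [Int.le_ceil (x * ((n : ℝ) + 1))]
        · intro n
          have hn : (0 : ℝ) < n + 1 := by positivity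
          simp only
          rw [div_le_iff₀ hn]
          push_cast
          linarith [Int.ceil_lt_add_one (x * ((n : ℝ) + 1))]
      · have hn : (0 : ℝ) < n + 1 := by positivity
        rw [mem_Iio, div_lt_iff₀ hn]
        push_cast
        linarith [Int.ceil_lt_add_one (x * ((n : ℝ) + 1))]
  refine ⟨L, hmeas, ?_⟩
  have hnull : ∀ m : ℕ, volume {x | 1 / ((m : ℝ) + 1) ≤ |f x - L x|} = 0 := by
    intro m
    refine measure_null_of_locally_null _ fun y hy => ⟨{y}, ?_, by simp⟩
    have := eventually_abs_sub_leftLimit_lt hL hr (by positivity : 0 < 1 / ((m : ℝ) + 1)) y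
    rw [eventually_nhdsWithin_iff] at this
    rw [mem_nhdsWithin_iff_eventually]
    filter_upwards [this] with x hx hxs
    by_contra hne
    exact absurd (hx hne) (not_lt.2 hxs)
  have : ∀ᵐ x, ∀ m : ℕ, ¬ 1 / ((m : ℝ) + 1) ≤ |f x - L x| :=
    ae_all_iff.2 fun m => by rw [ae_iff]; simpa using hnull m
  filter_upwards [this] with x hx
  by_contra hne
  obtain ⟨m, hm⟩ := exists_nat_one_div_lt (abs_pos.2 (sub_ne_zero.2 hne))
  exact hx m hm.le

section Waterman

variable {lam : ℕ → ℝ} {g : ℝ → ℝ}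

lemma exists_lamVarLE_period (hlam : IsWatermanSeq lam) (hg : g ∈ LambdaBV lam) (c : ℝ) :
    ∃ C, LamVarLE lam g (Icc c (c + 2 * π)) C := by
  obtain ⟨C, hC⟩ := exists_lamVarLE_of_mem hlam.pos hlam.mono hg
  exact hC.exists_shift hlam.pos hlam.mono hg.1 c

lemma exists_rightLimit (hlam : IsWatermanSeq lam) (hg : g ∈ LambdaBV lam) (x : ℝ) :
    ∃ l, Tendsto g (𝓝[>] x) (𝓝 l) := by
  obtain ⟨C, hC⟩ := exists_lamVarLE_period hlam hg x
  exact (hC.mono_set Ioo_subset_Icc_self).exists_tendsto_right hlam.pos hlam.diverges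
    (by linarith [pi_pos])

lemma exists_leftLimit (hlam : IsWatermanSeq lam) (hg : g ∈ LambdaBV lam) (x : ℝ) :
    ∃ l, Tendsto g (𝓝[<] x) (𝓝 l) := by
  obtain ⟨C, hC⟩ := exists_lamVarLE_period hlam hg (x - 2 * π)
  exact (hC.mono_set Ioo_subset_Icc_self).exists_tendsto_left hlam.pos hlam.diverges
    (by linarith [pi_pos]) |>.imp fun l hl => by simpa using hl

lemma exists_abs_le (hlam : IsWatermanSeq lam) (hg : g ∈ LambdaBV lam) :
    ∃ B, ∀ x, |g x| ≤ B := by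
  obtain ⟨C, hC⟩ := exists_lamVarLE_period hlam hg 0
  have h2 : (0 : ℝ) < 2 * π := by positivity
  refine ⟨C * lam 0 + |g 0|, fun x => ?_⟩
  obtain ⟨y, hy, hxy⟩ := hg.1.exists_mem_Ico₀ h2 x
  rw [hxy]
  have := hC.abs_sub_le hlam.pos (x := 0) (y := y) ⟨le_rfl, by linarith⟩
    ⟨hy.1, by linarith [hy.2]⟩
  have h3 := abs_add_le (g y - g 0) (g 0)
  rw [sub_add_cancel] at h3
  linarith

lemma aemeasurable_of_mem (hlam : IsWatermanSeq lam) (hg : g ∈ LambdaBV lam) :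
    AEMeasurable g volume :=
  aemeasurable_of_oneSided_limits (exists_leftLimit hlam hg) (exists_rightLimit hlam hg)

end Waterman

lemma intervalIntegrable_of_bdd {f : ℝ → ℝ} (hm : AEMeasurable f volume) {B : ℝ}
    (hB : ∀ x, |f x| ≤ B) (a b : ℝ) : IntervalIntegrable f volume a b := by
  refine (intervalIntegrable_const (c := B)).mono_fun hm.aestronglyMeasurable.restrict ?_
  exact Eventually.of_forall fun x => (hB x).trans (le_abs_self B)

lemma isWatermanSeq_harmonic : IsWatermanSeq fun i => (i : ℝ) + 1 where
  pos i := by positivity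
  mono i j h := by simpa using h
  tendsto := tendsto_atTop_add_const_right _ _ tendsto_natCast_atTop_atTop
  diverges h := by
    have := (summable_nat_add_iff (f := fun i : ℕ => 1 / (i : ℝ)) 1).1 (by simpa using h)
    exact Real.not_summable_one_div_natCast this

/-! ### Summation by parts and the tail kernel -/

/-- After Abel summation the remainder is `∑ (w k - w (k+1)) E (k+1)`; its coefficients are
nonnegative and telescope. -/
lemma abs_sum_by_parts_sub_le {w E : ℕ → ℝ} {B : ℝ} {n N : ℕ} (hnN : n ≤ N)
    (hw : ∀ k, n ≤ k → w (k + 1) ≤ w k) (hE : ∀ k, |E k| ≤ B) :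
    |∑ k ∈ Finset.Ico n N, w k * (E k - E (k + 1)) - (w n * E n - w N * E N)|
      ≤ B * (w n - w N) := by
  induction N, hnN using Nat.le_induction with
  | base => simp
  | succ N hN ih =>
    rw [Finset.sum_Ico_succ_top hN]
    have h1 : |(w N - w (N + 1)) * E (N + 1)| ≤ B * (w N - w (N + 1)) := by
      rw [abs_mul, abs_of_nonneg (sub_nonneg.2 (hw N hN)), mul_comm]
      exact mul_le_mul_of_nonneg_right (hE _) (sub_nonneg.2 (hw N hN))
    rw [abs_le] at *
    constructor <;> linarith [ih.1, ih.2, h1.1, h1.2]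

lemma abs_sum_by_parts_le {w E : ℕ → ℝ} {B : ℝ} {n : ℕ} (N : ℕ)
    (hw : ∀ k, n ≤ k → w (k + 1) ≤ w k) (hw0 : ∀ k, n ≤ k → 0 ≤ w k) (hE : ∀ k, |E k| ≤ B) :
    |∑ k ∈ Finset.Ico n N, w k * (E k - E (k + 1))| ≤ 2 * B * w n := by
  have hB : 0 ≤ B := (abs_nonneg _).trans (hE 0)
  rcases le_total n N with hnN | hnN
  · have h1 := abs_sum_by_parts_sub_le hnN hw hE
    have h2 : |w n * E n| ≤ B * w n := by
      rw [abs_mul, abs_of_nonneg (hw0 n le_rfl), mul_comm]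
      exact mul_le_mul_of_nonneg_right (hE _) (hw0 n le_rfl)
    have h3 : |w N * E N| ≤ B * w N := by
      rw [abs_mul, abs_of_nonneg (hw0 N hnN), mul_comm]
      exact mul_le_mul_of_nonneg_right (hE _) (hw0 N hnN)
    rw [abs_le] at *
    constructor <;> linarith [h1.1, h1.2, h2.1, h2.2, h3.1, h3.2]
  · rw [Finset.Ico_eq_empty_of_le hnN, Finset.sum_empty, abs_zero]
    have := hw0 n le_rfl
    positivity

/-- Division by `2 sin(t/2)` turns `sin kt` into a difference `E k - E (k+1)`, the form on which
summation by parts acts. -/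
lemma two_sin_half_mul_sin (k : ℕ) (t : ℝ) :
    2 * Real.sin (t / 2) * Real.sin (k * t)
      = Real.cos ((k - 1 / 2) * t) - Real.cos (((k + 1 : ℕ) - 1 / 2) * t) := by
  have h1 : ((k : ℝ) - 1 / 2) * t = k * t - t / 2 := by ring
  have h2 : (((k + 1 : ℕ) : ℝ) - 1 / 2) * t = k * t + t / 2 := by push_cast; ring
  rw [h1, h2, Real.cos_sub, Real.cos_add]
  ring

lemma two_sin_half_mul_cos (k : ℕ) (t : ℝ) :
    2 * Real.sin (t / 2) * Real.cos (k * t)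
      = Real.sin (((k + 1 : ℕ) - 1 / 2) * t) - Real.sin ((k - 1 / 2) * t) := by
  have h1 : ((k : ℝ) - 1 / 2) * t = k * t - t / 2 := by ring
  have h2 : (((k + 1 : ℕ) : ℝ) - 1 / 2) * t = k * t + t / 2 := by push_cast; ring
  rw [h1, h2, Real.sin_sub, Real.sin_add]
  ring

lemma div_pi_le_sin_half {t : ℝ} (h0 : 0 ≤ t) (hπ : t ≤ π) : t / π ≤ Real.sin (t / 2) := by
  have := Real.mul_le_sin (x := t / 2) (by linarith) (by linarith)
  calc t / π = 2 / π * (t / 2) := by ring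
    _ ≤ _ := this

lemma sin_half_pos {t : ℝ} (h0 : 0 < t) (hπ : t ≤ π) : 0 < Real.sin (t / 2) :=
  (div_pos h0 pi_pos).trans_le (div_pi_le_sin_half h0.le hπ)

lemma one_div_sin_half_le {t : ℝ} (h0 : 0 < t) (hπ : t ≤ π) : 1 / Real.sin (t / 2) ≤ π / t := by
  rw [div_le_div_iff₀ (sin_half_pos h0 hπ) h0]
  have := div_pi_le_sin_half h0.le hπ
  rw [div_le_iff₀ pi_pos] at this
  linarith

/-- The kernel `∑_{n ≤ k < N} (n / k)^p sin kt`. -/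
noncomputable def tailKernel (p n N : ℕ) (t : ℝ) : ℝ :=
  ∑ k ∈ Finset.Ico n N, ((n : ℝ) / k) ^ p * Real.sin (k * t)

/-- An antiderivative of `tailKernel`. -/
noncomputable def tailKernelPrim (p n N : ℕ) (t : ℝ) : ℝ :=
  -∑ k ∈ Finset.Ico n N, ((n : ℝ) / k) ^ p * (1 / k) * Real.cos (k * t)

lemma continuous_tailKernel (p n N : ℕ) : Continuous (tailKernel p n N) := by
  unfold tailKernel; fun_prop

lemma hasDerivAt_tailKernelPrim (p : ℕ) {n : ℕ} (hn : 1 ≤ n) (N : ℕ) (t : ℝ) :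
    HasDerivAt (tailKernelPrim p n N) (tailKernel p n N t) t := by
  have : ∀ k ∈ Finset.Ico n N, HasDerivAt
      (fun t : ℝ => ((n : ℝ) / k) ^ p * (1 / k) * Real.cos (k * t))
      (-(((n : ℝ) / k) ^ p * Real.sin (k * t))) t := by
    intro k hk
    have hk0 : (k : ℝ) ≠ 0 := by
      have := (Finset.mem_Ico.1 hk).1
      exact_mod_cast (by omega : k ≠ 0)
    have h1 : HasDerivAt (fun t : ℝ => (k : ℝ) * t) (k : ℝ) t := by
      simpa using (hasDerivAt_id t).const_mul (k : ℝ)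
    have h2 := (h1.cos).const_mul (((n : ℝ) / k) ^ p * (1 / k))
    exact h2.congr_deriv (by field_simp)
  have h := (HasDerivAt.fun_sum this).neg
  rw [Finset.sum_neg_distrib, neg_neg] at h
  exact h

lemma integral_tailKernel (p : ℕ) {n : ℕ} (hn : 1 ≤ n) (N : ℕ) (a b : ℝ) :
    ∫ t in a..b, tailKernel p n N t = tailKernelPrim p n N b - tailKernelPrim p n N a :=
  intervalIntegral.integral_eq_sub_of_hasDerivAt
    (fun t _ => hasDerivAt_tailKernelPrim p hn N t)
    ((continuous_tailKernel p n N).intervalIntegrable _ _)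

lemma div_pow_antitone (p : ℕ) {n : ℕ} (hn : 1 ≤ n) (k : ℕ) (hk : n ≤ k) :
    ((n : ℝ) / (k + 1 : ℕ)) ^ p ≤ ((n : ℝ) / k) ^ p := by
  have hk0 : (0 : ℝ) < k := by exact_mod_cast (by omega : 0 < k)
  gcongr
  linarith

lemma div_self_pow (p : ℕ) {n : ℕ} (hn : 1 ≤ n) : ((n : ℝ) / n) ^ p = 1 := by
  rw [div_self (by exact_mod_cast (by omega : n ≠ 0)), one_pow]

lemma abs_div_two_sin_half_le {t c : ℝ} (h0 : 0 < t) (hπ : t ≤ π) (hc : |c| ≤ 1) :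
    |c / (2 * Real.sin (t / 2))| ≤ 1 / (2 * Real.sin (t / 2)) := by
  have := sin_half_pos h0 hπ
  rw [abs_div, abs_of_pos (by positivity : 0 < 2 * Real.sin (t / 2))]
  gcongr

lemma abs_tailKernel_le_div (p : ℕ) {n : ℕ} (hn : 1 ≤ n) (N : ℕ) {t : ℝ} (h0 : 0 < t)
    (hπ : t ≤ π) : |tailKernel p n N t| ≤ π / t := by
  have hs := sin_half_pos h0 hπ
  have := abs_sum_by_parts_le (n := n) (w := fun k => ((n : ℝ) / k) ^ p)
    (E := fun k => Real.cos ((k - 1 / 2) * t) / (2 * Real.sin (t / 2))) N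
    (div_pow_antitone p hn) (fun k _ => by positivity)
    (fun k => abs_div_two_sin_half_le h0 hπ (Real.abs_cos_le_one _))
  simp only [div_self_pow p hn] at this
  refine le_trans (le_of_eq ?_) (this.trans (le_trans (le_of_eq ?_) (one_div_sin_half_le h0 hπ)))
  · congr 1
    refine Finset.sum_congr rfl fun k _ => ?_
    rw [← sub_div, ← two_sin_half_mul_sin]
    field_simp
  · field_simp

/-- The weights carry one more factor `1/k`, whose value at `k = n` is the gain over the bound for
the kernel itself. -/
lemma abs_tailKernelPrim_le (p : ℕ) {n : ℕ} (hn : 1 ≤ n) (N : ℕ) {t : ℝ} (h0 : 0 < t)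
    (hπ : t ≤ π) : |tailKernelPrim p n N t| ≤ π / (n * t) := by
  have hs := sin_half_pos h0 hπ
  have hn0 : (0 : ℝ) < n := by exact_mod_cast hn
  have := abs_sum_by_parts_le (n := n) (w := fun k => ((n : ℝ) / k) ^ p * (1 / k))
    (E := fun k => Real.sin ((k - 1 / 2) * t) / (2 * Real.sin (t / 2))) N
    (fun k hk => by
      have hk0 : (0 : ℝ) < k := by exact_mod_cast (by omega : 0 < k)
      have := div_pow_antitone p hn k hk
      gcongr
      linarith) (fun k _ => by positivity)
    (fun k => abs_div_two_sin_half_le h0 hπ (Real.abs_sin_le_one _))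
  simp only [div_self_pow p hn] at this
  refine le_trans (le_of_eq ?_) (this.trans (le_trans (le_of_eq ?_)
    (le_trans (mul_le_mul_of_nonneg_right (one_div_sin_half_le h0 hπ)
      (by positivity : (0 : ℝ) ≤ 1 / n)) (le_of_eq ?_))))
  · unfold tailKernelPrim
    rw [← Finset.sum_neg_distrib]
    congr 1
    refine Finset.sum_congr rfl fun k _ => ?_
    rw [← neg_sub, ← sub_div, ← two_sin_half_mul_cos]
    field_simp
  · field_simp
  · field_simp

lemma abs_tailKernel_le {p : ℕ} (hp : 2 ≤ p) {n : ℕ} (hn : 1 ≤ n) (N : ℕ) (t : ℝ) :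
    |tailKernel p n N t| ≤ 2 * n := by
  have hn0 : (0 : ℝ) < n := by exact_mod_cast hn
  have h1 : |tailKernel p n N t| ≤ ∑ k ∈ Finset.Ico n N, (n : ℝ) ^ 2 * (1 / (k : ℝ) ^ 2) := by
    refine (Finset.abs_sum_le_sum_abs _ _).trans (Finset.sum_le_sum fun k hk => ?_)
    have hk : n ≤ k := (Finset.mem_Ico.1 hk).1
    have hk0 : (0 : ℝ) < k := by exact_mod_cast (by omega : 0 < k)
    rw [abs_mul, abs_of_nonneg (by positivity)]
    calc ((n : ℝ) / k) ^ p * |Real.sin (k * t)| ≤ ((n : ℝ) / k) ^ p * 1 := by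
          gcongr; exact Real.abs_sin_le_one _
      _ ≤ ((n : ℝ) / k) ^ 2 * 1 := by
          gcongr ?_ * 1
          exact pow_le_pow_of_le_one (by positivity)
            ((div_le_one hk0).2 (by exact_mod_cast hk)) hp
      _ = _ := by rw [div_pow]; ring
  -- Telescoping, as `1/N^2 ≤ 2/(N(N+1))` for `N ≥ 1`.
  have h2 : ∀ N, n ≤ N → ∑ k ∈ Finset.Ico n N, 1 / (k : ℝ) ^ 2 ≤ 2 / (n : ℝ) - 2 / (N : ℝ) := by
    intro N hN
    induction N, hN using Nat.le_induction with
    | base => simp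
    | succ N hN ih =>
      rw [Finset.sum_Ico_succ_top hN]
      have hN0 : (1 : ℝ) ≤ N := by exact_mod_cast (by omega : 1 ≤ N)
      have : 1 / (N : ℝ) ^ 2 ≤ 2 / N - 2 / (N + 1 : ℕ) := by
        push_cast
        rw [div_sub_div _ _ (by positivity) (by positivity),
          div_le_div_iff₀ (by positivity) (by positivity)]
        nlinarith
      linarith
  refine h1.trans ?_
  rw [← Finset.mul_sum]
  rcases le_total n N with hN | hN
  · calc (n : ℝ) ^ 2 * ∑ k ∈ Finset.Ico n N, 1 / (k : ℝ) ^ 2 ≤ (n : ℝ) ^ 2 * (2 / (n : ℝ)) := by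
          gcongr
          have := h2 N hN
          have : (0 : ℝ) ≤ 2 / N := by positivity
          linarith
      _ = 2 * (n : ℝ) := by field_simp
  · rw [Finset.Ico_eq_empty_of_le hN, Finset.sum_empty, mul_zero]
    positivity

/-- A discrete form of `p ∫_n^N n^p x^(-p-1) dx = 1 - (n/N)^p`. Bernoulli's inequality compares
consecutive powers in each direction, the upper bound at the price of an index shift by one. -/
lemma sum_div_pow_bounds (p : ℕ) {n N : ℕ} (hn : 2 ≤ n) (hN : n ≤ N) :
    1 - ((n : ℝ) / N) ^ p ≤ p * ∑ k ∈ Finset.Ico n N, ((n : ℝ) / k) ^ p * (1 / k) ∧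
      p * ∑ k ∈ Finset.Ico n N, ((n : ℝ) / k) ^ p * (1 / k)
        ≤ ((n : ℝ) / (n - 1)) ^ p - ((n : ℝ) / (N - 1)) ^ p := by
  have hn0 : (2 : ℝ) ≤ n := by exact_mod_cast hn
  induction N, hN using Nat.le_induction with
  | base => simp [div_self_pow p (by omega : 1 ≤ n)]
  | succ N hN ih =>
    rw [Finset.sum_Ico_succ_top hN, mul_add]
    have hN0 : (2 : ℝ) ≤ N := by exact_mod_cast (by omega : 2 ≤ N)
    have e1 : ((n : ℝ) / N) ^ p * (1 - p * (1 / N)) ≤ ((n : ℝ) / (N + 1 : ℕ)) ^ p := by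
      have : ((n : ℝ) / (N + 1 : ℕ)) = (n / N) * (1 + -(1 / (N + 1))) := by
        push_cast; field_simp; ring
      rw [this, mul_pow]
      gcongr
      have hb := one_add_mul_le_pow (a := -(1 / ((N : ℝ) + 1))) (by
        have : 1 / ((N : ℝ) + 1) ≤ 1 := by rw [div_le_one (by positivity)]; linarith
        linarith) p
      have : p * (1 / ((N : ℝ) + 1)) ≤ p * (1 / N) := by gcongr; linarith
      linarith
    have e2 : ((n : ℝ) / N) ^ p * (1 + p * (1 / N)) ≤ ((n : ℝ) / (N - 1)) ^ p := by
      have hN1 : (0 : ℝ) < N - 1 := by linarith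
      have : ((n : ℝ) / (N - 1)) = (n / N) * (1 + (1 / (N - 1))) := by
        field_simp; ring
      rw [this, mul_pow]
      gcongr
      have hb := one_add_mul_le_pow (a := 1 / ((N : ℝ) - 1)) (by
        have : 0 < 1 / ((N : ℝ) - 1) := by positivity
        linarith) p
      have : p * (1 / (N : ℝ)) ≤ p * (1 / (N - 1)) := by gcongr; linarith
      linarith
    push_cast at e1 e2 ih ⊢
    rw [add_sub_cancel_right]
    constructor
    · linarith [ih.1]
    · linarith [ih.2]

/-- The integral is the difference of the antiderivative at the endpoints: its value at `π` is at
most `1/n` in modulus, while minus its value at `0` is the sum estimated in `sum_div_pow_bounds`. -/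
lemma eventually_abs_integral_tailKernel_sub_le {p : ℕ} (hp : 1 ≤ p) {ε : ℝ} (hε : 0 < ε) :
    ∀ᶠ n : ℕ in atTop, ∀ᶠ N in atTop, |(∫ t in 0..π, tailKernel p n N t) - 1 / p| ≤ ε := by
  have hp0 : (1 : ℝ) ≤ p := by exact_mod_cast hp
  have t1 : Tendsto (fun n : ℕ => ((n : ℝ) / (n - 1)) ^ p) atTop (𝓝 1) := by
    have h : Tendsto (fun n : ℕ => (n : ℝ) / (n - 1)) atTop (𝓝 1) := by
      have := tendsto_natCast_div_add_atTop (𝕜 := ℝ) (-1 : ℝ)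
      simpa [sub_eq_add_neg] using this
    simpa using h.pow p
  have t2 : Tendsto (fun n : ℕ => 1 / (n : ℝ)) atTop (𝓝 0) := tendsto_one_div_atTop_nhds_zero_nat
  filter_upwards [eventually_ge_atTop 2, t1.eventually (gt_mem_nhds (by linarith : 1 < 1 + ε / 2)),
    t2.eventually (gt_mem_nhds (by linarith : 0 < ε / 2))] with n hn h1 h2
  have t3 : Tendsto (fun N : ℕ => ((n : ℝ) / N) ^ p) atTop (𝓝 0) := by
    have := (tendsto_const_div_atTop_nhds_zero_nat (n : ℝ)).pow p
    rwa [zero_pow (by omega)] at this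
  filter_upwards [eventually_ge_atTop n, t3.eventually (gt_mem_nhds (by linarith : 0 < ε / 2))]
    with N hN h3
  obtain ⟨b1, b2⟩ := sum_div_pow_bounds p hn hN
  rw [integral_tailKernel p (by omega)]
  have hM := abs_tailKernelPrim_le p (by omega : 1 ≤ n) N pi_pos le_rfl
  have hM' : π / (n * π) = 1 / n := by field_simp
  rw [hM'] at hM
  have h0 : tailKernelPrim p n N 0 = -∑ k ∈ Finset.Ico n N, ((n : ℝ) / k) ^ p * (1 / k) := by
    simp [tailKernelPrim]
  rw [h0]
  set S := ∑ k ∈ Finset.Ico n N, ((n : ℝ) / k) ^ p * (1 / k)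
  have h4 : 0 ≤ ((n : ℝ) / (N - 1)) ^ p := by
    have : (2 : ℝ) ≤ N := by exact_mod_cast (by omega : 2 ≤ N)
    have : (0 : ℝ) ≤ N - 1 := by linarith
    positivity
  have hS : |S - 1 / p| ≤ ε / 2 := by
    have : S - 1 / p = (p * S - 1) / p := by field_simp
    rw [this, abs_div, abs_of_pos (by linarith : (0 : ℝ) < p), div_le_iff₀ (by linarith)]
    have h5 : |p * S - 1| ≤ ε / 2 := by rw [abs_le]; constructor <;> linarith
    exact h5.trans (le_mul_of_one_le_right (by linarith) hp0)
  rw [abs_le] at *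
  constructor <;> linarith [hM.1, hM.2, hS.1, hS.2]

/-! ### Pairing the kernel with functions of bounded harmonic variation -/

/-- Supplies a near-maximal oscillation point in each grid cell; the supremum need not be attained,
whence the factor 2. -/
lemma exists_forall_le_two_mul {α : Type*} {S : Set α} (hS : S.Nonempty) {f : α → ℝ}
    (hf : ∀ x ∈ S, 0 ≤ f x) {B : ℝ} (hB : ∀ x ∈ S, f x ≤ B) :
    ∃ s ∈ S, ∀ x ∈ S, f x ≤ 2 * f s := by
  have hbdd : BddAbove (f '' S) := ⟨B, by rintro _ ⟨x, hx, rfl⟩; exact hB x hx⟩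
  obtain ⟨x₀, hx₀⟩ := hS
  rcases le_or_gt (sSup (f '' S)) 0 with h0 | h0
  · refine ⟨x₀, hx₀, fun x hx => ?_⟩
    have := (le_csSup hbdd (mem_image_of_mem f hx)).trans h0
    linarith [hf x₀ hx₀]
  · obtain ⟨_, ⟨s, hs, rfl⟩, hlt⟩ := exists_lt_of_lt_csSup ⟨_, mem_image_of_mem f hx₀⟩
      (half_lt_self h0)
    exact ⟨s, hs, fun x hx => by linarith [le_csSup hbdd (mem_image_of_mem f hx)]⟩

lemma sum_range_mul_sub (u v : ℕ → ℝ) (m : ℕ) :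
    ∑ i ∈ Finset.range m, u i * (v (i + 1) - v i)
      = u m * v m - u 0 * v 0 - ∑ i ∈ Finset.range m, (u (i + 1) - u i) * v (i + 1) := by
  induction m with
  | zero => simp
  | succ m ih => rw [Finset.sum_range_succ, Finset.sum_range_succ, ih]; ring

/-- On the first cell `|K| ≤ 2n` suffices. On the others `φ` is replaced by its value at the left
endpoint: the difference is paid for by `|K| ≤ π/t`, and the resulting step function is summed by
parts against the antiderivative of `K`. Both leave increments weighted by `1/(i+1)`. The points `s
i` are chosen before `N`, so the bound is uniform in `N`. -/
lemma abs_integral_mul_tailKernel_le {p : ℕ} (hp : 2 ≤ p) {φ : ℝ → ℝ} {B η : ℝ}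
    (hint : IntervalIntegrable φ volume 0 π) (hB : ∀ x ∈ Ioc 0 π, ∀ y ∈ Ioc 0 π, |φ y - φ x| ≤ B)
    (m : ℕ) (t : ℕ → ℝ) (ht : ∀ i, t i = i * (π / (m + 1))) (hη : ∀ x ∈ Ioc 0 (t 1), |φ x| ≤ η) :
    ∃ s : ℕ → ℝ, (∀ i < m, s i ∈ Icc (t (i + 1)) (t (i + 2))) ∧ ∀ N,
      |∫ x in 0..π, φ x * tailKernel p (m + 1) N x| ≤ (2 * π + 1) * η + |φ π| / (m + 1)
        + (2 * π + 2) * ∑ i ∈ Finset.range m, |φ (s i) - φ (t (i + 1))| / (i + 1) := by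
  have hm0 : (0 : ℝ) < m + 1 := by positivity
  have hd : 0 < π / (m + 1) := by positivity
  have htmono : ∀ i j, i ≤ j → t i ≤ t j := fun i j hij => by
    rw [ht, ht]
    have : (i : ℝ) ≤ j := by exact_mod_cast hij
    gcongr
  have ht0 : t 0 = 0 := by simp [ht]
  have htm : t (m + 1) = π := by rw [ht]; push_cast; field_simp
  have htpos : ∀ i, 0 < t (i + 1) := fun i => by rw [ht]; positivity
  have htπ : ∀ i, i ≤ m + 1 → t i ≤ π := fun i hi => htm ▸ htmono i _ hi
  have hstep : ∀ i, t (i + 1) - t i = π / (m + 1) := fun i => by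
    rw [ht, ht]; push_cast; ring
  have hsub : ∀ i < m, ∀ x ∈ Icc (t (i + 1)) (t (i + 2)), x ∈ Ioc 0 π := fun i hi x hx =>
    ⟨(htpos i).trans_le hx.1, hx.2.trans (htπ _ (by omega))⟩
  have hs : ∀ i, ∃ s, i < m → s ∈ Icc (t (i + 1)) (t (i + 2)) ∧
      ∀ x ∈ Icc (t (i + 1)) (t (i + 2)),
        |φ x - φ (t (i + 1))| ≤ 2 * |φ s - φ (t (i + 1))| := by
    intro i
    by_cases hi : i < m
    · have hle := htmono (i + 1) (i + 2) (by omega)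
      obtain ⟨s, hs, hs'⟩ := exists_forall_le_two_mul (f := fun x => |φ x - φ (t (i + 1))|)
        (nonempty_Icc.2 hle) (fun x _ => abs_nonneg _) (fun x hx =>
          hB _ (hsub i hi _ (left_mem_Icc.2 hle)) x (hsub i hi x hx))
      exact ⟨s, fun _ => ⟨hs, hs'⟩⟩
    · exact ⟨0, fun h => absurd h hi⟩
  choose s hs using hs
  refine ⟨s, fun i hi => (hs i hi).1, fun N => ?_⟩
  set n := m + 1 with hn
  have hn1 : 1 ≤ n := by omega
  have hncast : ((n : ℕ) : ℝ) = m + 1 := by rw [hn]; push_cast; rfl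
  set K := tailKernel p n N with hK
  set P := tailKernelPrim p n N with hP
  have hKc : Continuous K := continuous_tailKernel p n N
  have hsubint : ∀ i ≤ m, IntervalIntegrable φ volume (t i) (t (i + 1)) := fun i hi =>
    hint.mono_set (by
      rw [uIcc_of_le (htmono i _ (by omega)), uIcc_of_le pi_pos.le]
      exact Icc_subset_Icc (ht0 ▸ htmono 0 i (by omega)) (htπ _ (by omega)))
  have hsplit : ∫ x in 0..π, φ x * K x = (∑ i ∈ Finset.range m,
      ∫ x in t (i + 1)..t (i + 2), φ x * K x) + ∫ x in t 0..t 1, φ x * K x := by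
    rw [← Finset.sum_range_succ' (fun i => ∫ x in t i..t (i + 1), φ x * K x),
      intervalIntegral.sum_integral_adjacent_intervals, ht0, htm]
    exact fun i hi => (hsubint i (by omega)).mul_continuousOn hKc.continuousOn
  have hfirst : |∫ x in t 0..t 1, φ x * K x| ≤ 2 * π * η := by
    have := intervalIntegral.norm_integral_le_of_norm_le_const (a := t 0) (b := t 1)
      (f := fun x => φ x * K x) (C := η * (2 * n)) (fun x hx => by
        rw [uIoc_of_le (htmono 0 1 (by omega)), ht0] at hx
        rw [norm_mul]
        exact mul_le_mul (hη x hx) (abs_tailKernel_le hp hn1 N x) (abs_nonneg _)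
          ((abs_nonneg _).trans (hη x hx)))
    rw [hstep 0, abs_of_pos hd, hncast] at this
    refine this.trans (le_of_eq ?_)
    field_simp
  have hpiece : ∀ i ∈ Finset.range m, ∫ x in t (i + 1)..t (i + 2), φ x * K x
      = (∫ x in t (i + 1)..t (i + 2), (φ x - φ (t (i + 1))) * K x)
        + φ (t (i + 1)) * (P (t (i + 2)) - P (t (i + 1))) := by
    intro i hi
    rw [← integral_tailKernel p hn1 N, ← intervalIntegral.integral_const_mul,
      ← intervalIntegral.integral_add]
    · congr 1
      funext x
      ring
    · exact ((hsubint (i + 1) (by simpa using hi)).sub intervalIntegrable_const).mul_continuousOn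
        hKc.continuousOn
    · exact (hKc.const_mul _).intervalIntegrable _ _ 
  have hpiece1 : ∀ i ∈ Finset.range m,
      |∫ x in t (i + 1)..t (i + 2), (φ x - φ (t (i + 1))) * K x|
        ≤ 2 * π * (|φ (s i) - φ (t (i + 1))| / (i + 1)) := by
    intro i hi
    have hi := Finset.mem_range.1 hi
    have hle := htmono (i + 1) (i + 2) (by omega)
    have := intervalIntegral.norm_integral_le_of_norm_le_const (a := t (i + 1)) (b := t (i + 2))
      (f := fun x => (φ x - φ (t (i + 1))) * K x)
      (C := 2 * |φ (s i) - φ (t (i + 1))| * (π / t (i + 1))) (fun x hx => by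
        rw [uIoc_of_le hle] at hx
        have hx' := Ioc_subset_Icc_self hx
        have hxI := hsub i hi x hx'
        rw [norm_mul]
        refine mul_le_mul ((hs i hi).2 x hx') ?_ (abs_nonneg _) (by positivity)
        refine (abs_tailKernel_le_div p hn1 N hxI.1 hxI.2).trans ?_
        have := htpos i
        exact div_le_div_of_nonneg_left pi_pos.le this hx.1.le)
    rw [hstep (i + 1), abs_of_pos hd] at this
    refine this.trans (le_of_eq ?_)
    rw [ht]
    push_cast
    field_simp
  have hPb : ∀ i ≤ m, |P (t (i + 1))| ≤ 1 / (i + 1) := by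
    intro i hi
    refine (abs_tailKernelPrim_le p hn1 N (htpos i) (htπ _ (by omega))).trans (le_of_eq ?_)
    rw [ht, hncast]
    push_cast
    field_simp
  have hparts := sum_range_mul_sub (fun i => φ (t (i + 1))) (fun i => P (t (i + 1))) m
  have htm' : t (m + 1) = π := htm
  simp only [zero_add] at hparts
  rw [htm'] at hparts
  rw [hsplit, Finset.sum_congr rfl hpiece, Finset.sum_add_distrib, hparts]
  have b1 : |∑ i ∈ Finset.range m, ∫ x in t (i + 1)..t (i + 2), (φ x - φ (t (i + 1))) * K x|
      ≤ 2 * π * ∑ i ∈ Finset.range m, |φ (s i) - φ (t (i + 1))| / (i + 1) := by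
    rw [Finset.mul_sum]
    exact (Finset.abs_sum_le_sum_abs _ _).trans (Finset.sum_le_sum hpiece1)
  have b2 : |∑ i ∈ Finset.range m, (φ (t (i + 1 + 1)) - φ (t (i + 1))) * P (t (i + 1 + 1))|
      ≤ 2 * ∑ i ∈ Finset.range m, |φ (s i) - φ (t (i + 1))| / (i + 1) := by
    rw [Finset.mul_sum]
    refine (Finset.abs_sum_le_sum_abs _ _).trans (Finset.sum_le_sum fun i hi => ?_)
    have hi := Finset.mem_range.1 hi
    rw [abs_mul]
    have h1 := (hs i hi).2 (t (i + 2)) (right_mem_Icc.2 (htmono _ _ (by omega)))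
    have h2 : |P (t (i + 1 + 1))| ≤ 1 / (i + 1) := by
      refine (hPb (i + 1) (by omega)).trans ?_
      push_cast
      gcongr
      linarith
    calc _ ≤ 2 * |φ (s i) - φ (t (i + 1))| * (1 / (i + 1)) :=
          mul_le_mul h1 h2 (abs_nonneg _) (by positivity)
      _ = _ := by ring
  have b3 : |φ π * P π| ≤ |φ π| / (m + 1) := by
    rw [abs_mul, ← htm]
    calc _ ≤ |φ (t (m + 1))| * (1 / (m + 1)) :=
          mul_le_mul_of_nonneg_left (hPb m le_rfl) (abs_nonneg _)
      _ = _ := by ring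
  have b4 : |φ (t 1) * P (t 1)| ≤ η := by
    rw [abs_mul]
    have h1 := hPb 0 (by omega)
    simp only [zero_add, CharP.cast_eq_zero, div_one] at h1
    have h2 := hη (t 1) ⟨htpos 0, le_rfl⟩
    calc _ ≤ η * 1 := mul_le_mul h2 h1 (abs_nonneg _) ((abs_nonneg _).trans h2)
      _ = η := mul_one η
  rw [abs_le] at *
  constructor <;> linarith [b1.1, b1.2, b2.1, b2.2, b3.1, b3.2, b4.1, b4.2, hfirst.1, hfirst.2]

/-- Beyond distance `δ` the weight `1/(i+1)` is at most `2π/(δ(m+1))`, so only the plain sum of the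
increments matters, and `h` makes it `O(m/H)`. -/
lemma sum_filter_far_le (m : ℕ) {x : ℕ → ℝ} {δ C H : ℝ} (hδ : 0 < δ) (hC : 0 ≤ C)
    (hx : ∀ i, 0 ≤ x i) (hH : 0 < H) (h : (∑ i ∈ Finset.range m, x i) * H ≤ m * C) :
    ∑ i ∈ Finset.range m with ¬ ((i + 2 : ℕ) : ℝ) * (π / (m + 1)) ≤ δ, x i / ((i : ℝ) + 1)
      ≤ 2 * π / δ * C / H := by
  rw [← le_div_iff₀ hH] at h
  have hm0 : (0 : ℝ) < m + 1 := by positivity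
  have hc : 0 ≤ 2 * π / (δ * (m + 1)) := by positivity
  calc _ ≤ ∑ i ∈ Finset.range m with ¬ ((i + 2 : ℕ) : ℝ) * (π / (m + 1)) ≤ δ,
        2 * π / (δ * (m + 1)) * x i := by
        refine Finset.sum_le_sum fun i hi => ?_
        have hi := not_le.1 (Finset.mem_filter.1 hi).2
        rw [div_eq_mul_inv, mul_comm]
        refine mul_le_mul_of_nonneg_right ?_ (hx i)
        rw [inv_le_comm₀ (by positivity) (by positivity), inv_div]
        rw [mul_div_assoc', lt_div_iff₀ hm0] at hi
        rw [div_le_iff₀ (by positivity)]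
        push_cast at hi
        have : 0 ≤ (i : ℝ) * π := by positivity
        linarith
    _ ≤ ∑ i ∈ Finset.range m, 2 * π / (δ * (m + 1)) * x i :=
        Finset.sum_le_sum_of_subset_of_nonneg (Finset.filter_subset _ _)
          fun i _ _ => mul_nonneg hc (hx i)
    _ = 2 * π / (δ * (m + 1)) * ∑ i ∈ Finset.range m, x i := by rw [Finset.mul_sum]
    _ ≤ 2 * π / (δ * (m + 1)) * ((m + 1) * C / H) := by
        refine mul_le_mul_of_nonneg_left (h.trans ?_) hc
        gcongr
        linarith
    _ = 2 * π / δ * C / H := by field_simp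

/-- The kernels `tailKernel` integrate functions of bounded harmonic variation with vanishing
limit at `0` to quantities that tend to zero. -/
lemma eventually_abs_integral_mul_tailKernel_le {p : ℕ} (hp : 2 ≤ p) {φ : ℝ → ℝ} {C : ℝ}
    (hint : IntervalIntegrable φ volume 0 π)
    (h : LamVarLE (fun i => (i : ℝ) + 1) φ (Ioc 0 π) C) (h0 : Tendsto φ (𝓝[>] 0) (𝓝 0))
    {ε : ℝ} (hε : 0 < ε) :
    ∀ᶠ n : ℕ in atTop, ∀ N, |∫ x in 0..π, φ x * tailKernel p n N x| ≤ ε := by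
  set A := 2 * π + 2 with hA
  have hApos : 0 < A := by positivity
  have hη : 0 < ε / (4 * A) := by positivity
  obtain ⟨δ, hδ, hδπ, hvar⟩ := h.exists_harmonic_le pi_pos h0 hη
  have hev : ∀ᶠ x in 𝓝[>] (0 : ℝ), |φ x| < ε / (4 * A) := by
    have := h0.abs
    rw [abs_zero] at this
    exact this.eventually (gt_mem_nhds hη)
  obtain ⟨δ', hδ', hsm⟩ := (mem_nhdsGT_iff_exists_Ioc_subset).1 hev
  have hB : ∀ x ∈ Ioc 0 π, ∀ y ∈ Ioc 0 π, |φ y - φ x| ≤ C := fun x hx y hy => by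
    simpa using h.abs_sub_le (fun i => by positivity) hx hy
  have l1 : Tendsto (fun n : ℕ => π / ((n : ℝ) + 1)) atTop (𝓝 0) :=
    tendsto_const_nhds.div_atTop
      (tendsto_atTop_add_const_right _ _ tendsto_natCast_atTop_atTop)
  have l2 : Tendsto (fun n : ℕ => |φ π| / ((n : ℝ) + 1)) atTop (𝓝 0) :=
    tendsto_const_nhds.div_atTop
      (tendsto_atTop_add_const_right _ _ tendsto_natCast_atTop_atTop)
  have l3 : Tendsto (fun n : ℕ => 2 * π / δ * C / ∑ j ∈ Finset.range n, 1 / ((j : ℝ) + 1))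
      atTop (𝓝 0) :=
    tendsto_const_nhds.div_atTop Real.tendsto_sum_range_one_div_nat_succ_atTop
  have hall : ∀ᶠ m : ℕ in atTop, ∀ N, |∫ x in 0..π, φ x * tailKernel p (m + 1) N x| ≤ ε := by
    filter_upwards [eventually_ge_atTop 1, l1.eventually (gt_mem_nhds hδ'),
      l2.eventually (gt_mem_nhds (by positivity : 0 < ε / 4)),
      l3.eventually (gt_mem_nhds hη)] with m hm h1 h2 h3 N
    set t : ℕ → ℝ := fun i => i * (π / (m + 1)) with ht
    have htmono : Monotone t := fun i j hij => by
      have : (i : ℝ) ≤ j := by exact_mod_cast hij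
      simp only [ht]
      gcongr
    obtain ⟨s, hs, hbound⟩ := abs_integral_mul_tailKernel_le hp (η := ε / (4 * A)) hint hB m t
      (fun i => rfl) (fun x hx => (hsm ⟨hx.1, hx.2.trans (by simpa [ht] using h1.le)⟩).le)
    have hdisj : ∀ i < m, ∀ j < m, i ≠ j →
        Disjoint (Ioo (t (i + 1)) (s i)) (Ioo (t (j + 1)) (s j)) := by
      intro i hi j hj hij
      rw [Set.disjoint_left]
      intro z hz hz'
      have hi2 := (hs i hi).2
      have hj2 := (hs j hj).2
      rcases lt_or_gt_of_ne hij with hlt | hlt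
      · linarith [htmono (show i + 2 ≤ j + 1 by omega), hz.2, hz'.1]
      · linarith [htmono (show j + 2 ≤ i + 1 by omega), hz.1, hz'.2]
    have htpos : ∀ i, 0 < t (i + 1) := fun i => by simp only [ht]; positivity
    have hmem : ∀ i < m, t (i + 2) ≤ π := fun i hi => by
      simp only [ht]
      rw [mul_div_assoc', div_le_iff₀ (by positivity), mul_comm]
      have : ((i + 2 : ℕ) : ℝ) ≤ m + 1 := by exact_mod_cast (by omega : i + 2 ≤ m + 1)
      gcongr
    have hS : ∑ i ∈ Finset.range m, |φ (s i) - φ (t (i + 1))| / ((i : ℝ) + 1)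
        ≤ ε / (4 * A) + ε / (4 * A) := by
      -- Cells inside `(0, δ]` are controlled by the small local variation, the others by the
      -- averaged bound.
      rw [← Finset.sum_filter_add_sum_filter_not _ (fun i => t (i + 2) ≤ δ)]
      refine add_le_add ?_ ?_
      · refine hvar ℕ _ (fun i => t (i + 1)) s id (injOn_id _) (fun i hi => ?_)
          fun i hi j hj hij => ?_
        · obtain ⟨hi, hiδ⟩ := Finset.mem_filter.1 hi
          have := hs i (Finset.mem_range.1 hi)
          exact ⟨⟨htpos i, (this.1.trans this.2).trans hiδ⟩,
            ⟨(htpos i).trans_le this.1, this.2.trans hiδ⟩, this.1⟩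
        · exact hdisj i (Finset.mem_range.1 (Finset.mem_filter.1 hi).1) j
            (Finset.mem_range.1 (Finset.mem_filter.1 hj).1) hij
      · have hH : 0 < ∑ j ∈ Finset.range m, 1 / ((j : ℝ) + 1) :=
          Finset.sum_pos (fun j _ => by positivity) (by simp; omega)
        have hmean := h.sum_mul_harmonic_le m (fun i => t (i + 1)) s (fun i hi => by
          have := hs i hi
          exact ⟨⟨htpos i, (this.1.trans this.2).trans (hmem i hi)⟩,
            ⟨(htpos i).trans_le this.1, this.2.trans (hmem i hi)⟩, this.1⟩) hdisj
        have hC : 0 ≤ C := (abs_nonneg _).trans (hB π ⟨pi_pos, le_rfl⟩ π ⟨pi_pos, le_rfl⟩)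
        exact (sum_filter_far_le m hδ hC (fun i => abs_nonneg _) hH hmean).trans h3.le
    refine (hbound N).trans ?_
    have e1 : (2 * π + 1) * (ε / (4 * A)) ≤ ε / 4 := by
      calc (2 * π + 1) * (ε / (4 * A)) ≤ A * (ε / (4 * A)) := by gcongr; linarith
        _ = ε / 4 := by field_simp
    have e2 : A * (ε / (4 * A) + ε / (4 * A)) = ε / 2 := by field_simp; ring
    have e3 := mul_le_mul_of_nonneg_left hS hApos.le
    linarith
  have := (tendsto_sub_atTop_nat 1).eventually hall
  filter_upwards [this, eventually_ge_atTop 1] with n hn hn1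
  rwa [Nat.sub_add_cancel hn1] at hn

/-! ### Existence of the conjugate tails in `L²` -/

section Orthogonality

lemma integral_cos_int_mul (m : ℤ) :
    ∫ x in (-π)..π, Real.cos (m * x) = if m = 0 then 2 * π else 0 := by
  split_ifs with h
  · simp [h]; ring
  · have hm : (m : ℝ) ≠ 0 := by exact_mod_cast h
    rw [intervalIntegral.integral_comp_mul_left _ hm, integral_cos]
    simp [Real.sin_int_mul_pi]

lemma integral_cos_mul_cos (j k : ℕ) :
    ∫ x in (-π)..π, Real.cos ((j + 1 : ℕ) * x) * Real.cos ((k + 1 : ℕ) * x)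
      = if j = k then π else 0 := by
  have : ∀ x : ℝ, Real.cos ((j + 1 : ℕ) * x) * Real.cos ((k + 1 : ℕ) * x)
      = (1 / 2) * Real.cos (((j - k : ℤ) : ℝ) * x)
        + (1 / 2) * Real.cos (((j + k + 2 : ℤ) : ℝ) * x) := by
    intro x
    have h1 : ((j - k : ℤ) : ℝ) * x = (j + 1 : ℕ) * x - (k + 1 : ℕ) * x := by push_cast; ring
    have h2 : ((j + k + 2 : ℤ) : ℝ) * x = (j + 1 : ℕ) * x + (k + 1 : ℕ) * x := by
      push_cast; ring
    rw [h1, h2, Real.cos_sub, Real.cos_add]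
    ring
  simp_rw [this]
  rw [intervalIntegral.integral_add (Continuous.intervalIntegrable (by fun_prop) _ _)
    (Continuous.intervalIntegrable (by fun_prop) _ _), intervalIntegral.integral_const_mul,
    intervalIntegral.integral_const_mul, integral_cos_int_mul, integral_cos_int_mul,
    if_neg (by omega : ¬ ((j : ℤ) + k + 2 = 0))]
  by_cases h : j = k
  · simp [h]
  · rw [if_neg h, if_neg (by omega)]; simp

lemma integral_sin_mul_sin (j k : ℕ) :
    ∫ x in (-π)..π, Real.sin ((j + 1 : ℕ) * x) * Real.sin ((k + 1 : ℕ) * x)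
      = if j = k then π else 0 := by
  have : ∀ x : ℝ, Real.sin ((j + 1 : ℕ) * x) * Real.sin ((k + 1 : ℕ) * x)
      = (1 / 2) * Real.cos (((j - k : ℤ) : ℝ) * x)
        - (1 / 2) * Real.cos (((j + k + 2 : ℤ) : ℝ) * x) := by
    intro x
    have h1 : ((j - k : ℤ) : ℝ) * x = (j + 1 : ℕ) * x - (k + 1 : ℕ) * x := by push_cast; ring
    have h2 : ((j + k + 2 : ℤ) : ℝ) * x = (j + 1 : ℕ) * x + (k + 1 : ℕ) * x := by
      push_cast; ring
    rw [h1, h2, Real.cos_sub, Real.cos_add]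
    ring
  simp_rw [this]
  rw [intervalIntegral.integral_sub (Continuous.intervalIntegrable (by fun_prop) _ _)
    (Continuous.intervalIntegrable (by fun_prop) _ _), intervalIntegral.integral_const_mul,
    intervalIntegral.integral_const_mul, integral_cos_int_mul, integral_cos_int_mul,
    if_neg (by omega : ¬ ((j : ℤ) + k + 2 = 0))]
  by_cases h : j = k
  · simp [h]
  · rw [if_neg h, if_neg (by omega)]; simp

end Orthogonality

/-- Bessel's inequality and completeness: transplanting the coefficients of a square integrable
function from one orthogonal system to another gives a convergent series. -/
lemma summable_toLp_transplant {μ : Measure ℝ} {c : ℝ} (hc : 0 < c) {u v : ℕ → ℝ → ℝ}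
    (hu : ∀ k, MemLp (u k) 2 μ) (hv : ∀ k, MemLp (v k) 2 μ)
    (huo : ∀ j k, ∫ x, u j x * u k x ∂μ = if j = k then c else 0)
    (hvo : ∀ j k, ∫ x, v j x * v k x ∂μ = if j = k then c else 0)
    {g : ℝ → ℝ} (hg : MemLp g 2 μ) :
    Summable fun k => (∫ x, g x * u k x ∂μ) • (hv k).toLp (v k) := by
  have hinner : ∀ {f h : ℝ → ℝ} (hf : MemLp f 2 μ) (hh : MemLp h 2 μ),
      inner ℝ (hf.toLp f) (hh.toLp h) = ∫ x, f x * h x ∂μ := by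
    intro f h hf hh
    rw [L2.inner_def]
    refine integral_congr_ae ?_
    filter_upwards [hf.coeFn_toLp, hh.coeFn_toLp] with x h1 h2
    rw [h1, h2]
    simp [mul_comm]
  have hsq : √c * √c = c := Real.mul_self_sqrt hc.le
  have hsq0 : √c ≠ 0 := (Real.sqrt_pos.2 hc).ne'
  have horth : ∀ {w : ℕ → ℝ → ℝ} (hw : ∀ k, MemLp (w k) 2 μ),
      (∀ j k, ∫ x, w j x * w k x ∂μ = if j = k then c else 0) →
      Orthonormal ℝ fun k => (√c)⁻¹ • (hw k).toLp (w k) := by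
    intro w hw hwo
    rw [orthonormal_iff_ite]
    intro j k
    rw [real_inner_smul_left, real_inner_smul_right, hinner, hwo]
    split_ifs
    · nth_rewrite 3 [← hsq]
      field_simp
    · simp
  have h1 := (horth hu huo).inner_products_summable (hg.toLp g)
  have h2 := ((horth hv hvo).orthogonalFamily.summable_iff_norm_sq_summable _).2 h1
  refine (h2.const_smul c).congr fun k => ?_
  rw [LinearIsometry.toSpanSingleton_apply, real_inner_smul_left, hinner, smul_smul, smul_smul]
  congr 1
  have : ∫ x, u k x * g x ∂μ = ∫ x, g x * u k x ∂μ := by simp_rw [mul_comm]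
  rw [this]
  nth_rewrite 1 [← hsq]
  field_simp

lemma continuous_conjTerm (g : ℝ → ℝ) (k : ℕ) : Continuous (conjTerm g k) := by
  unfold conjTerm; fun_prop

lemma periodic_conjTerm (g : ℝ → ℝ) (k : ℕ) : Function.Periodic (conjTerm g k) (2 * π) := by
  intro x
  have : (k : ℝ) * (x + 2 * π) = k * x + k * (2 * π) := by ring
  simp only [conjTerm]
  rw [this, Real.sin_add_nat_mul_two_pi, Real.cos_add_nat_mul_two_pi]

lemma memLp_of_continuous {f : ℝ → ℝ} (hf : Continuous f) :
    MemLp f 2 (volume.restrict (Ioc (-π) π)) := by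
  obtain ⟨B, hB⟩ := isCompact_Icc.exists_bound_of_continuousOn (s := Icc (-π) π) hf.continuousOn
  refine MemLp.of_bound hf.aestronglyMeasurable B ?_
  filter_upwards [ae_restrict_mem measurableSet_Ioc] with x hx
  exact hB x (Ioc_subset_Icc_self hx)

/-- The tails of the conjugate Fourier series of a square integrable function exist. -/
lemma exists_isConjTail {g : ℝ → ℝ} (hg : MemLp g 2 (volume.restrict (Ioc (-π) π))) (n : ℕ) :
    ∃ R, IsConjTail g n R := by
  set μ := volume.restrict (Ioc (-π) π) with hμ
  have hint : ∀ f : ℝ → ℝ, ∫ x, f x ∂μ = ∫ x in (-π)..π, f x := fun f => by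
    rw [intervalIntegral.integral_of_le (by linarith [pi_pos])]
  have hS : ∀ k : ℕ, MemLp (fun x => Real.sin ((k + 1 : ℕ) * x)) 2 μ := fun k =>
    memLp_of_continuous (by fun_prop)
  have hC : ∀ k : ℕ, MemLp (fun x => Real.cos ((k + 1 : ℕ) * x)) 2 μ := fun k =>
    memLp_of_continuous (by fun_prop)
  have hT : ∀ k, MemLp (conjTerm g k) 2 μ := fun k => memLp_of_continuous (continuous_conjTerm g k)
  -- Conjugation sends cosine coefficients to sines and sine coefficients to cosines. Indices start
  -- at 1, because frequency 0 has a different norm; one term does not affect summability.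
  have s1 := summable_toLp_transplant pi_pos hC hS
    (fun j k => by rw [hint, integral_cos_mul_cos]) (fun j k => by rw [hint, integral_sin_mul_sin]) hg
  have s2 := summable_toLp_transplant pi_pos hS hC
    (fun j k => by rw [hint, integral_sin_mul_sin]) (fun j k => by rw [hint, integral_cos_mul_cos]) hg
  have hsum1 : Summable fun k => (hT (k + 1)).toLp (conjTerm g (k + 1)) := by
    refine ((s1.sub s2).const_smul (1 / π)).congr fun k => ?_
    rw [← MemLp.toLp_const_smul, ← MemLp.toLp_const_smul, ← MemLp.toLp_sub,
      ← MemLp.toLp_const_smul, hint, hint]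
    refine MemLp.toLp_congr _ _ (Eventually.of_forall fun x => ?_)
    simp only [Pi.smul_apply, Pi.sub_apply, smul_eq_mul, conjTerm, cosCoeff, sinCoeff]
    ring
  have hsum : Summable fun k => (hT k).toLp (conjTerm g k) :=
    (summable_nat_add_iff (f := fun k => (hT k).toLp (conjTerm g k)) 1).1 hsum1
  have hlim := ((summable_nat_add_iff n).2 hsum).hasSum.tendsto_sum_nat
  set F := ∑' k, (hT (k + n)).toLp (conjTerm g (k + n)) with hF
  have h2π : (0 : ℝ) < 2 * π := by positivity
  set R : ℝ → ℝ := fun x => F (toIocMod h2π (-π) x) with hR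
  have hRF : R =ᵐ[μ] F := by
    filter_upwards [ae_restrict_mem measurableSet_Ioc] with x hx
    simp only [hR]
    rw [(toIocMod_eq_self h2π).2 ⟨hx.1, by linarith [hx.2]⟩]
  have hRL : MemLp R 2 μ := (memLp_congr_ae hRF).2 (Lp.memLp F)
  refine ⟨R, fun x => by simp only [hR, toIocMod_add_right], hRL, ?_⟩
  have hP : ∀ N, MemLp (fun x => ∑ k ∈ Finset.Ico n N, conjTerm g k x) 2 μ := fun N =>
    memLp_finsetSum _ fun k _ => hT k
  refine (Lp.tendsto_Lp_iff_tendsto_eLpNorm'' _ hP R hRL).1 ?_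
  have hRF' : hRL.toLp R = F := by
    apply Lp.ext
    exact hRL.coeFn_toLp.trans hRF
  rw [hRF']
  have hcomp := hlim.comp (tendsto_sub_atTop_nat n)
  refine hcomp.congr fun N => ?_
  simp only [Function.comp_apply]
  rw [Finset.sum_congr rfl fun k _ => by rw [add_comm k n],
    ← Finset.sum_Ico_eq_sum_range (fun k => (hT k).toLp (conjTerm g k))]
  apply Lp.ext
  refine (Lp.coeFn_finsetSum _ _).trans ?_
  refine EventuallyEq.trans ?_ (hP N).coeFn_toLp.symm
  have : ∀ᵐ x ∂μ, ∀ k, (hT k).toLp (conjTerm g k) x = conjTerm g k x :=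
    ae_all_iff.2 fun k => (hT k).coeFn_toLp
  filter_upwards [this] with x hx
  simp [hx]

/-! ### Repeated primitives, term by term -/

lemma zeroMeanPrimitive_eq_of_hasDerivAt {P Q : ℝ → ℝ} (hP : Continuous P)
    (hQ : ∀ x, HasDerivAt Q (P x) x) (hmean : ∫ x in (-π)..π, Q x = 0) :
    zeroMeanPrimitive P = Q := by
  have hFTC : ∀ x, ∫ t in (0 : ℝ)..x, P t = Q x - Q 0 := fun x =>
    intervalIntegral.integral_eq_sub_of_hasDerivAt (fun t _ => hQ t) (hP.intervalIntegrable _ _)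
  have hQc : Continuous Q := continuous_iff_continuousAt.2 fun x => (hQ x).continuousAt
  funext x
  simp only [zeroMeanPrimitive, hFTC]
  rw [intervalIntegral.integral_sub (hQc.intervalIntegrable _ _) intervalIntegrable_const, hmean,
    intervalIntegral.integral_const, smul_eq_mul]
  field_simp
  ring

/-- The trigonometric polynomial `∑ (α_k sin kx + β_k cos kx)`. -/
noncomputable def trigSum (s : Finset ℕ) (α β : ℕ → ℝ) (x : ℝ) : ℝ :=
  ∑ k ∈ s, (α k * Real.sin (k * x) + β k * Real.cos (k * x))

lemma continuous_trigSum (s : Finset ℕ) (α β : ℕ → ℝ) : Continuous (trigSum s α β) := by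
  unfold trigSum; fun_prop

lemma integral_trigSum {s : Finset ℕ} (hs : ∀ k ∈ s, 1 ≤ k) (α β : ℕ → ℝ) :
    ∫ x in (-π)..π, trigSum s α β x = 0 := by
  unfold trigSum
  rw [intervalIntegral.integral_finsetSum fun k _ =>
    Continuous.intervalIntegrable (by fun_prop) _ _]
  refine Finset.sum_eq_zero fun k hk => ?_
  have hk0 : (k : ℝ) ≠ 0 := by
    have := hs k hk
    exact_mod_cast (by omega : k ≠ 0)
  rw [intervalIntegral.integral_add (Continuous.intervalIntegrable (by fun_prop) _ _)
    (Continuous.intervalIntegrable (by fun_prop) _ _), intervalIntegral.integral_const_mul,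
    intervalIntegral.integral_const_mul, intervalIntegral.integral_comp_mul_left _ hk0,
    intervalIntegral.integral_comp_mul_left _ hk0, integral_sin, integral_cos]
  simp [Real.sin_nat_mul_pi]

lemma zeroMeanPrimitive_trigSum {s : Finset ℕ} (hs : ∀ k ∈ s, 1 ≤ k) (α β : ℕ → ℝ) :
    zeroMeanPrimitive (trigSum s α β) = trigSum s (fun k => β k / k) (fun k => -α k / k) := by
  refine zeroMeanPrimitive_eq_of_hasDerivAt (continuous_trigSum _ _ _) (fun x => ?_)
    (integral_trigSum hs _ _)
  unfold trigSum
  refine HasDerivAt.fun_sum fun k hk => ?_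
  have hk0 : (k : ℝ) ≠ 0 := by
    have := hs k hk
    exact_mod_cast (by omega : k ≠ 0)
  have h1 : HasDerivAt (fun t : ℝ => (k : ℝ) * t) (k : ℝ) x := by
    simpa using (hasDerivAt_id x).const_mul (k : ℝ)
  exact ((h1.sin.const_mul (β k / k)).add (h1.cos.const_mul (-α k / k))).congr_deriv
    (by field_simp; ring)

/-- Each pair of primitives restores sines to sines and cosines to cosines with the factor `-1/k^2`.
-/
lemma iteratedPrimitive_trigSum {s : Finset ℕ} (hs : ∀ k ∈ s, 1 ≤ k) (α β : ℕ → ℝ) (r : ℕ) :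
    iteratedPrimitive (2 * r) (trigSum s α β)
      = trigSum s (fun k => (-1) ^ r * (1 / (k : ℝ)) ^ (2 * r) * α k)
          (fun k => (-1) ^ r * (1 / (k : ℝ)) ^ (2 * r) * β k) := by
  induction r generalizing α β with
  | zero => simp [iteratedPrimitive]
  | succ r ih =>
    have : iteratedPrimitive (2 * (r + 1)) (trigSum s α β)
        = iteratedPrimitive (2 * r) (zeroMeanPrimitive (zeroMeanPrimitive (trigSum s α β))) := by
      simp only [iteratedPrimitive, mul_add, mul_one, Function.iterate_add, Function.comp_apply]
      rfl
    rw [this, zeroMeanPrimitive_trigSum hs, zeroMeanPrimitive_trigSum hs, ih]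
    congr 1 <;> funext k <;> ring

lemma continuous_zeroMeanPrimitive {f : ℝ → ℝ} (hf : ∀ a b, IntervalIntegrable f volume a b) :
    Continuous (zeroMeanPrimitive f) :=
  (intervalIntegral.continuous_primitive hf 0).sub continuous_const

/-- The primitive is continuous from `L¹` to the uniform norm: the integral and its mean each
contribute one copy of the `L¹` distance. The condition `π ≤ M` keeps the interval of the mean
inside `[-M, M]`. -/
lemma abs_zeroMeanPrimitive_sub_le {f g : ℝ → ℝ} (hf : ∀ a b, IntervalIntegrable f volume a b)
    (hg : ∀ a b, IntervalIntegrable g volume a b) {M : ℝ} (hM : π ≤ M) {x : ℝ}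
    (hx : x ∈ Icc (-M) M) :
    |zeroMeanPrimitive f x - zeroMeanPrimitive g x| ≤ 2 * ∫ t in (-M)..M, |f t - g t| := by
  set I := ∫ t in (-M)..M, |f t - g t| with hI
  have hM0 : 0 < M := pi_pos.trans_le hM
  have hfg : ∀ a b, IntervalIntegrable (fun t => f t - g t) volume a b := fun a b =>
    (hf a b).sub (hg a b)
  have key : ∀ y ∈ Icc (-M) M, |(∫ t in (0 : ℝ)..y, f t) - ∫ t in (0 : ℝ)..y, g t| ≤ I := by
    intro y hy
    rw [← intervalIntegral.integral_sub (hf _ _) (hg _ _)]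
    refine (intervalIntegral.norm_integral_le_abs_integral_norm (f := fun t => f t - g t)).trans ?_
    have h1 : abs (∫ t in (0 : ℝ)..y, |f t - g t|) ≤ abs (∫ t in (-M)..M, |f t - g t|) := by
      refine intervalIntegral.abs_integral_mono_interval ?_
        (Eventually.of_forall fun t => abs_nonneg _) (hfg _ _).abs
      rw [uIoc_of_le (by linarith : -M ≤ M)]
      intro t ht
      rw [mem_uIoc] at ht
      rcases ht with ht | ht
      · exact ⟨by linarith [ht.1], ht.2.trans hy.2⟩
      · exact ⟨hy.1.trans_lt ht.1, by linarith [ht.2]⟩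
    exact h1.trans_eq (abs_of_nonneg
      (intervalIntegral.integral_nonneg (by linarith) fun t _ => abs_nonneg _))
  have hcont : ∀ h : ℝ → ℝ, (∀ a b, IntervalIntegrable h volume a b) →
      IntervalIntegrable (fun y => ∫ t in (0 : ℝ)..y, h t) volume (-π) π := fun h hh =>
    (intervalIntegral.continuous_primitive hh 0).intervalIntegrable _ _
  have h2 : |(∫ y in (-π)..π, ∫ t in (0 : ℝ)..y, f t) - ∫ y in (-π)..π, ∫ t in (0 : ℝ)..y, g t|
      ≤ I * (2 * π) := by
    rw [← intervalIntegral.integral_sub (hcont f hf) (hcont g hg)]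
    have := intervalIntegral.norm_integral_le_of_norm_le_const (a := -π) (b := π) (C := I)
      (f := fun y => (∫ t in (0 : ℝ)..y, f t) - ∫ t in (0 : ℝ)..y, g t) (fun y hy => by
        rw [uIoc_of_le (by linarith [pi_pos])] at hy
        exact key y ⟨by linarith [hy.1], by linarith [hy.2]⟩)
    refine this.trans (le_of_eq ?_)
    rw [abs_of_pos (by linarith [pi_pos])]
    ring
  have h3 : |(1 / (2 * π)) * ((∫ y in (-π)..π, ∫ t in (0 : ℝ)..y, f t)
      - ∫ y in (-π)..π, ∫ t in (0 : ℝ)..y, g t)| ≤ I := by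
    rw [abs_mul, abs_of_pos (by positivity), one_div_mul_eq_div, div_le_iff₀ (by positivity)]
    exact h2
  have h4 := key x hx
  simp only [zeroMeanPrimitive]
  rw [abs_le] at *
  constructor <;> linarith [h3.1, h3.2, h4.1, h4.2]

lemma abs_iterate_zeroMeanPrimitive_sub_le {f g : ℝ → ℝ}
    (hf : ∀ a b, IntervalIntegrable f volume a b)
    (hg : ∀ a b, IntervalIntegrable g volume a b) {M : ℝ} (hM : π ≤ M) (m : ℕ) {x : ℝ}
    (hx : x ∈ Icc (-M) M) :
    |iteratedPrimitive (m + 1) f x - iteratedPrimitive (m + 1) g x|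
      ≤ 2 * (4 * M) ^ m * ∫ t in (-M)..M, |f t - g t| := by
  have hM0 : 0 < M := pi_pos.trans_le hM
  induction m generalizing f g with
  | zero => simpa [iteratedPrimitive] using abs_zeroMeanPrimitive_sub_le hf hg hM hx
  | succ m ih =>
    have hf' := continuous_zeroMeanPrimitive hf
    have hg' := continuous_zeroMeanPrimitive hg
    have h1 := ih (fun a b => hf'.intervalIntegrable a b) (fun a b => hg'.intervalIntegrable a b)
    refine h1.trans ?_
    set I := ∫ t in (-M)..M, |f t - g t|
    have h2 : ∫ t in (-M)..M, |zeroMeanPrimitive f t - zeroMeanPrimitive g t| ≤ 2 * I * (2 * M) := by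
      have := intervalIntegral.norm_integral_le_of_norm_le_const (a := -M) (b := M) (C := 2 * I)
        (f := fun t => |zeroMeanPrimitive f t - zeroMeanPrimitive g t|) (fun y hy => by
          rw [uIoc_of_le (by linarith)] at hy
          rw [Real.norm_eq_abs, abs_abs]
          exact abs_zeroMeanPrimitive_sub_le hf hg hM (Ioc_subset_Icc_self hy))
      refine (le_abs_self _).trans (this.trans (le_of_eq ?_))
      rw [abs_of_pos (by linarith)]
      ring
    calc _ ≤ 2 * (4 * M) ^ m * (2 * I * (2 * M)) := by gcongr
      _ = _ := by ring

lemma intervalIntegrable_of_memLp {R : ℝ → ℝ} (hper : Function.Periodic R (2 * π))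
    (hR : MemLp R 2 (volume.restrict (Ioc (-π) π))) (a b : ℝ) :
    IntervalIntegrable R volume a b := by
  refine hper.intervalIntegrable (t := -π) (by positivity) ?_ a b
  have : -π + 2 * π = π := by ring
  rw [this, intervalIntegrable_iff_integrableOn_Ioc_of_le (by linarith [pi_pos])]
  exact hR.integrable (by norm_num)

/-- The repeated primitives of a tail of the conjugate Fourier series may be computed
term by term. -/
lemma tendsto_iteratedPrimitive {g : ℝ → ℝ} {n : ℕ} (hn : 1 ≤ n) {R : ℝ → ℝ}
    (hR : IsConjTail g n R) {r : ℕ} (hr : 1 ≤ r) (x : ℝ) :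
    Tendsto (fun N => (-1) ^ r * ∑ k ∈ Finset.Ico n N, (1 / (k : ℝ)) ^ (2 * r) * conjTerm g k x)
      atTop (𝓝 (iteratedPrimitive (2 * r) R x)) := by
  obtain ⟨hper, hmem, hlim⟩ := hR
  set S : ℕ → ℝ → ℝ := fun N x => ∑ k ∈ Finset.Ico n N, conjTerm g k x with hS
  have hScont : ∀ N, Continuous (S N) := fun N =>
    continuous_finsetSum _ fun k _ => continuous_conjTerm g k
  have hSper : ∀ N, Function.Periodic (S N) (2 * π) := fun N y => by
    simp only [hS]
    exact Finset.sum_congr rfl fun k _ => periodic_conjTerm g k y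
  have hRint := intervalIntegrable_of_memLp hper hmem
  obtain ⟨J, hJ⟩ := exists_nat_ge |x|
  -- An odd multiple of `π` makes `[-M, M]` a whole number of periods, so the `L¹` distance over it
  -- is `2J + 1` times that over `[-π, π]`.
  set M : ℝ := (2 * J + 1) * π with hM
  have hπ := pi_gt_three
  have hJ0 : (0 : ℝ) ≤ J := Nat.cast_nonneg J
  have hMπ : π ≤ M := by rw [hM]; nlinarith
  have hxM : x ∈ Icc (-M) M := by
    refine abs_le.1 ?_
    refine hJ.trans ?_
    rw [hM]; nlinarith
  have hL1 : Tendsto (fun N => ∫ t in (-M)..M, |S N t - R t|) atTop (𝓝 0) := by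
    have h1 : ∀ N, ∫ t in (-M)..M, |S N t - R t|
        = (2 * J + 1 : ℤ) • ∫ t in (-π)..π, |S N t - R t| := by
      intro N
      have hp : Function.Periodic (fun t => |S N t - R t|) (2 * π) := fun t => by
        simp only [hSper N t, hper t]
      have hi : ∀ a b, IntervalIntegrable (fun t => |S N t - R t|) volume a b := fun a b =>
        (((hScont N).intervalIntegrable a b).sub (hRint a b)).abs
      have e1 : -M + (2 * J + 1 : ℤ) • (2 * π) = M := by
        rw [hM, zsmul_eq_mul]; push_cast; ring
      have e2 := hp.intervalIntegral_add_zsmul_eq (2 * J + 1 : ℤ) (-M) hi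
      rw [e1, hp.intervalIntegral_add_eq (-M) (-π)] at e2
      rw [e2]
      congr 2
      ring
    have h2 : ∀ N, ENNReal.ofReal (∫ t in (-π)..π, |S N t - R t|)
        ≤ eLpNorm (fun x => S N x - R x) 2 (volume.restrict (Ioc (-π) π))
          * (volume.restrict (Ioc (-π) π)) univ ^ (1 / (1 : ENNReal).toReal - 1 / (2 : ENNReal).toReal) := by
      intro N
      rw [intervalIntegral.integral_of_le (by linarith)]
      have hm : MemLp (fun x => S N x - R x) 2 (volume.restrict (Ioc (-π) π)) :=
        (memLp_of_continuous (hScont N)).sub hmem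
      refine le_trans (le_of_eq ?_) (eLpNorm_le_eLpNorm_mul_rpow_measure_univ (p := 1) (q := 2)
        (by norm_num) hm.aestronglyMeasurable)
      rw [eLpNorm_one_eq_lintegral_enorm]
      exact ofReal_integral_norm_eq_lintegral_enorm (hm.integrable (by norm_num))
    have h3 : Tendsto (fun N => eLpNorm (fun x => S N x - R x) 2 (volume.restrict (Ioc (-π) π))
          * (volume.restrict (Ioc (-π) π)) univ ^ (1 / (1 : ENNReal).toReal - 1 / (2 : ENNReal).toReal))
          atTop (𝓝 0) := by
      have := ENNReal.Tendsto.mul_const (b := (volume.restrict (Ioc (-π) π)) univ ^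
        (1 / (1 : ENNReal).toReal - 1 / (2 : ENNReal).toReal)) hlim (Or.inr (by
          refine ENNReal.rpow_ne_top_of_nonneg (by norm_num) ?_
          simp))
      simpa using this
    have h4 := tendsto_of_tendsto_of_tendsto_of_le_of_le tendsto_const_nhds h3
      (fun N => zero_le) h2
    have h5 := (ENNReal.tendsto_toReal ENNReal.zero_ne_top).comp h4
    have h6 : Tendsto (fun N => ∫ t in (-π)..π, |S N t - R t|) atTop (𝓝 0) := by
      refine (by simpa using h5 : Tendsto _ _ (𝓝 (0 : ℝ))).congr fun N => ?_
      simp only [Function.comp_apply]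
      exact ENNReal.toReal_ofReal
        (intervalIntegral.integral_nonneg (by linarith) fun t _ => abs_nonneg _)
    simp_rw [h1]
    simpa using h6.const_smul (2 * J + 1 : ℤ)
  have hmain : Tendsto (fun N => iteratedPrimitive (2 * r) (S N) x) atTop
      (𝓝 (iteratedPrimitive (2 * r) R x)) := by
    obtain ⟨m, hm⟩ : ∃ m, 2 * r = m + 1 := ⟨2 * r - 1, by omega⟩
    rw [hm, tendsto_iff_norm_sub_tendsto_zero]
    refine squeeze_zero (fun N => norm_nonneg _) (fun N =>
      abs_iterate_zeroMeanPrimitive_sub_le (fun a b => (hScont N).intervalIntegrable a b) hRint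
        hMπ m hxM) ?_
    simpa using hL1.const_mul (2 * (4 * M) ^ m)
  refine hmain.congr fun N => ?_
  have : S N = trigSum (Finset.Ico n N) (cosCoeff g) (fun k => -sinCoeff g k) := by
    funext y
    simp only [hS, trigSum, conjTerm]
    exact Finset.sum_congr rfl fun k _ => by ring
  rw [this, iteratedPrimitive_trigSum fun k hk => hn.trans (Finset.mem_Ico.1 hk).1]
  simp only [trigSum, conjTerm]
  rw [Finset.mul_sum]
  exact Finset.sum_congr rfl fun k _ => by ring

/-! ### Integral representation of the tails -/

section Bounded

variable {g : ℝ → ℝ} {B : ℝ}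

lemma integral_symm_mul_sin (hm : AEMeasurable g volume) (hB : ∀ x, |g x| ≤ B) (k : ℕ) :
    ∫ u in (-π)..π, g u * Real.sin (k * u)
      = ∫ u in (0 : ℝ)..π, (g u - g (-u)) * Real.sin (k * u) := by
  have hi : ∀ a b, IntervalIntegrable (fun u => g u * Real.sin (k * u)) volume a b := fun a b =>
    (intervalIntegrable_of_bdd hm hB a b).mul_continuousOn (by fun_prop)
  have hneg : ∫ u in (-π)..0, g u * Real.sin (k * u)
      = ∫ u in (0 : ℝ)..π, g (-u) * Real.sin (k * -u) := by
    rw [intervalIntegral.integral_comp_neg fun u => g u * Real.sin (k * u), neg_zero]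
  have hi' : IntervalIntegrable (fun u => g (-u) * Real.sin (k * -u)) volume 0 π := by
    have := (hi 0 (-π)).comp_sub_left 0
    simpa using this
  rw [← intervalIntegral.integral_add_adjacent_intervals (hi (-π) 0) (hi 0 π), hneg,
    ← intervalIntegral.integral_add hi' (hi 0 π)]
  congr 1
  funext u
  rw [mul_neg, Real.sin_neg]
  ring

/-- The term is a convolution of `g` with `sin kt`. Periodicity moves the window to be centred at
`x`, and oddness of the sine folds it onto `[0, π]`. -/
lemma conjTerm_eq_integral (hper : Function.Periodic g (2 * π)) (hm : AEMeasurable g volume)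
    (hB : ∀ x, |g x| ≤ B) (k : ℕ) (x : ℝ) :
    conjTerm g k x = -(1 / π) * ∫ u in (0 : ℝ)..π, (g (x + u) - g (x - u)) * Real.sin (k * u) := by
  have hgi := intervalIntegrable_of_bdd hm hB
  have h1 : conjTerm g k x = (1 / π) * ∫ t in (-π)..π, g t * Real.sin (k * (x - t)) := by
    have : ∀ t, g t * Real.sin (k * (x - t)) = g t * Real.cos (k * t) * Real.sin (k * x)
        - g t * Real.sin (k * t) * Real.cos (k * x) := fun t => by
      rw [mul_sub, Real.sin_sub]; ring
    simp_rw [this]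
    rw [intervalIntegral.integral_sub
      (((hgi _ _).mul_continuousOn (by fun_prop)).mul_continuousOn (by fun_prop))
      (((hgi _ _).mul_continuousOn (by fun_prop)).mul_continuousOn (by fun_prop)),
      intervalIntegral.integral_mul_const, intervalIntegral.integral_mul_const]
    simp only [conjTerm, cosCoeff, sinCoeff]
    ring
  have hp : Function.Periodic (fun t => g t * Real.sin (k * (x - t))) (2 * π) := fun t => by
    have : (k : ℝ) * (x - (t + 2 * π)) = k * (x - t) - k * (2 * π) := by ring
    simp only [hper t, this, Real.sin_sub_nat_mul_two_pi]
  have h2 : ∫ t in (-π)..π, g t * Real.sin (k * (x - t))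
      = ∫ u in (-π)..π, g (x + u) * Real.sin (k * -u) := by
    have e := hp.intervalIntegral_add_eq (-π) (x + -π)
    have e1 : -π + 2 * π = π := by ring
    have e2 : x + -π + 2 * π = x + π := by ring
    rw [e1, e2] at e
    rw [e, ← intervalIntegral.integral_comp_add_left]
    congr 1
    funext u
    rw [sub_add_cancel_left]
  have hm' : AEMeasurable (fun u => g (x + u)) volume :=
    hm.comp_quasiMeasurePreserving (measurePreserving_add_left volume x).quasiMeasurePreserving
  have h3 := integral_symm_mul_sin hm' (fun u => hB (x + u)) k
  rw [h1, h2]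
  simp_rw [mul_neg, Real.sin_neg, mul_neg]
  rw [intervalIntegral.integral_neg, h3]
  simp_rw [← sub_eq_add_neg]
  ring

lemma intervalIntegrable_symm (hm : AEMeasurable g volume) (hB : ∀ x, |g x| ≤ B) (x a b : ℝ) :
    IntervalIntegrable (fun u => g (x + u)) volume a b ∧
      IntervalIntegrable (fun u => g (x - u)) volume a b := by
  constructor
  · exact intervalIntegrable_of_bdd (hm.comp_quasiMeasurePreserving
      (measurePreserving_add_left volume x).quasiMeasurePreserving) (fun u => hB (x + u)) a b
  · exact intervalIntegrable_of_bdd (hm.comp_quasiMeasurePreserving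
      (volume.measurePreserving_sub_left x).quasiMeasurePreserving) (fun u => hB (x - u)) a b

lemma sum_conjTerm_eq_integral (hper : Function.Periodic g (2 * π)) (hm : AEMeasurable g volume)
    (hB : ∀ x, |g x| ≤ B) (p n N : ℕ) (x : ℝ) :
    (n : ℝ) ^ p * ∑ k ∈ Finset.Ico n N, (1 / (k : ℝ)) ^ p * conjTerm g k x
      = -(1 / π) * ∫ u in (0 : ℝ)..π, (g (x + u) - g (x - u)) * tailKernel p n N u := by
  simp only [tailKernel, Finset.mul_sum]
  obtain ⟨h1, h2⟩ := intervalIntegrable_symm hm hB x 0 π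
  rw [intervalIntegral.integral_finsetSum fun k _ =>
    (h1.sub h2).mul_continuousOn (by fun_prop), Finset.mul_sum]
  refine Finset.sum_congr rfl fun k _ => ?_
  rw [conjTerm_eq_integral hper hm hB]
  have : ∀ u, (g (x + u) - g (x - u)) * (((n : ℝ) / k) ^ p * Real.sin (k * u))
      = ((n : ℝ) / k) ^ p * ((g (x + u) - g (x - u)) * Real.sin (k * u)) := fun u => by ring
  simp_rw [this]
  rw [intervalIntegral.integral_const_mul]
  ring

lemma memLp_two_of_bdd (hm : AEMeasurable g volume) (hB : ∀ x, |g x| ≤ B) :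
    MemLp g 2 (volume.restrict (Ioc (-π) π)) :=
  MemLp.of_bound hm.aestronglyMeasurable.restrict B (Eventually.of_forall hB)

/-- The scaled repeated primitive of the tail as a limit of integrals. -/
lemma tendsto_integral_tailKernel (hper : Function.Periodic g (2 * π))
    (hm : AEMeasurable g volume) (hB : ∀ x, |g x| ≤ B) {r : ℕ} (hr : 1 ≤ r) {n : ℕ} (hn : 1 ≤ n)
    {R : ℝ → ℝ} (hR : IsConjTail g n R) (x : ℝ) :
    Tendsto (fun N => (-1) ^ (r + 1) / π *
        ∫ u in (0 : ℝ)..π, (g (x + u) - g (x - u)) * tailKernel (2 * r) n N u) atTop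
      (𝓝 ((n : ℝ) ^ (2 * r) * iteratedPrimitive (2 * r) R x)) := by
  refine ((tendsto_iteratedPrimitive hn hR hr x).const_mul ((n : ℝ) ^ (2 * r))).congr fun N => ?_
  have := sum_conjTerm_eq_integral hper hm hB (2 * r) n N x
  rw [mul_left_comm, this, pow_succ]
  ring

end Bounded

/-! ### The jump formula -/

/-- Subtracting the one-sided limits leaves two functions vanishing at `0+`, whose pairings are
negligible. The constant `gr - gl` is multiplied by the mass of the kernel. -/
lemma eventually_abs_integral_sub_jump_le {g : ℝ → ℝ} (hg : g ∈ HBV) {x gl gr : ℝ}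
    (hl : Tendsto g (𝓝[<] x) (𝓝 gl)) (hr : Tendsto g (𝓝[>] x) (𝓝 gr)) {p : ℕ} (hp : 2 ≤ p)
    {ε : ℝ} (hε : 0 < ε) :
    ∀ᶠ n : ℕ in atTop, ∀ᶠ N in atTop,
      |(∫ u in (0 : ℝ)..π, (g (x + u) - g (x - u)) * tailKernel p n N u) - (gr - gl) / p| ≤ ε := by
  have hlam := isWatermanSeq_harmonic
  obtain ⟨B, hB⟩ := exists_abs_le hlam hg
  have hm := aemeasurable_of_mem hlam hg
  obtain ⟨i1, i2⟩ := intervalIntegrable_symm hm hB x 0 π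
  obtain ⟨C₁, h₁⟩ := exists_lamVarLE_period hlam hg x
  obtain ⟨C₂, h₂⟩ := exists_lamVarLE_period hlam hg (x - 2 * π)
  have hπ := pi_pos
  have v1 : LamVarLE (fun i => (i : ℝ) + 1) (fun u => g (x + u) - gr) (Ioc 0 π) C₁ := by
    have := (h₁.comp_add x).sub_const gr
    simp_rw [add_comm _ x] at this
    exact this.mono_set fun u hu => ⟨by linarith [hu.1], by linarith [hu.2]⟩
  have v2 : LamVarLE (fun i => (i : ℝ) + 1) (fun u => g (x - u) - gl) (Ioc 0 π) C₂ := by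
    have := ((h₂.comp_add x).comp_neg).sub_const gl
    simp_rw [neg_add_eq_sub] at this
    refine this.mono_set fun u hu => ?_
    change -u + x ∈ Icc (x - 2 * π) (x - 2 * π + 2 * π)
    exact ⟨by linarith [hu.2], by linarith [hu.1]⟩
  have t1 : Tendsto (fun u => g (x + u) - gr) (𝓝[>] 0) (𝓝 0) := by
    have : Tendsto (fun u => x + u) (𝓝[>] 0) (𝓝[>] x) := by
      refine tendsto_nhdsWithin_iff.2 ⟨?_, ?_⟩
      · have : Tendsto (fun u => x + u) (𝓝 0) (𝓝 (x + 0)) := by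
          exact (continuous_const.add continuous_id).tendsto 0
        rw [add_zero] at this
        exact this.mono_left nhdsWithin_le_nhds
      · filter_upwards [self_mem_nhdsWithin] with u hu
        simpa using hu
    simpa using (hr.comp this).sub_const gr
  have t2 : Tendsto (fun u => g (x - u) - gl) (𝓝[>] 0) (𝓝 0) := by
    have : Tendsto (fun u => x - u) (𝓝[>] 0) (𝓝[<] x) := by
      refine tendsto_nhdsWithin_iff.2 ⟨?_, ?_⟩
      · have : Tendsto (fun u => x - u) (𝓝 0) (𝓝 (x - 0)) := by
          exact (continuous_const.sub continuous_id).tendsto 0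
        rw [sub_zero] at this
        exact this.mono_left nhdsWithin_le_nhds
      · filter_upwards [self_mem_nhdsWithin] with u hu
        simpa using hu
    simpa using (hl.comp this).sub_const gl
  have i1' : IntervalIntegrable (fun u => g (x + u) - gr) volume 0 π :=
    i1.sub intervalIntegrable_const
  have i2' : IntervalIntegrable (fun u => g (x - u) - gl) volume 0 π :=
    i2.sub intervalIntegrable_const
  set J := |gr - gl| with hJ
  have hJ0 : 0 ≤ J := abs_nonneg _
  filter_upwards [eventually_abs_integral_mul_tailKernel_le hp i1' v1 t1
      (by positivity : 0 < ε / 4),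
    eventually_abs_integral_mul_tailKernel_le hp i2' v2 t2 (by positivity : 0 < ε / 4),
    eventually_abs_integral_tailKernel_sub_le (by omega : 1 ≤ p)
      (by positivity : 0 < ε / (2 * (J + 1)))] with n e1 e2 e3
  filter_upwards [e3] with N e3
  have e1 := e1 N
  have e2 := e2 N
  have hK := continuous_tailKernel p n N
  have hsplit : ∫ u in (0 : ℝ)..π, (g (x + u) - g (x - u)) * tailKernel p n N u
      = (∫ u in (0 : ℝ)..π, (g (x + u) - gr) * tailKernel p n N u)
        - (∫ u in (0 : ℝ)..π, (g (x - u) - gl) * tailKernel p n N u)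
        + (gr - gl) * ∫ u in (0 : ℝ)..π, tailKernel p n N u := by
    rw [← intervalIntegral.integral_const_mul, ← intervalIntegral.integral_sub
      (i1'.mul_continuousOn hK.continuousOn) (i2'.mul_continuousOn hK.continuousOn),
      ← intervalIntegral.integral_add ((i1'.mul_continuousOn hK.continuousOn).sub
        (i2'.mul_continuousOn hK.continuousOn)) ((hK.const_mul _).intervalIntegrable _ _)]
    congr 1
    funext u
    ring
  have e4 : |(gr - gl) * ((∫ u in (0 : ℝ)..π, tailKernel p n N u) - 1 / p)| ≤ ε / 2 := by
    rw [abs_mul]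
    calc _ ≤ (J + 1) * (ε / (2 * (J + 1))) :=
          mul_le_mul (by linarith) e3 (abs_nonneg _) (by linarith)
      _ = ε / 2 := by field_simp
  rw [mul_sub, mul_one_div] at e4
  rw [hsplit]
  rw [abs_le] at *
  constructor <;> linarith [e1.1, e1.2, e2.1, e2.2, e4.1, e4.2]

/-- The jump formula on `HBV`. -/
lemma tendsto_iteratedPrimitive_of_mem_HBV {g : ℝ → ℝ} (hg : g ∈ HBV) {x gl gr : ℝ}
    (hl : Tendsto g (𝓝[<] x) (𝓝 gl)) (hr : Tendsto g (𝓝[>] x) (𝓝 gr)) {r : ℕ} (hr1 : 1 ≤ r)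
    {R : ℕ → ℝ → ℝ} (hR : ∀ n, IsConjTail g n (R n)) :
    Tendsto (fun n : ℕ => (n : ℝ) ^ (2 * r) * iteratedPrimitive (2 * r) (R n) x) atTop
      (𝓝 ((-1 : ℝ) ^ (r + 1) / (2 * (r : ℝ) * π) * (gr - gl))) := by
  obtain ⟨B, hB⟩ := exists_abs_le isWatermanSeq_harmonic hg
  have hm := aemeasurable_of_mem isWatermanSeq_harmonic hg
  rw [Metric.tendsto_nhds]
  intro ε hε
  have hr0 : (0 : ℝ) < r := by exact_mod_cast hr1
  filter_upwards [eventually_ge_atTop 1, eventually_abs_integral_sub_jump_le hg hl hr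
    (by omega : 2 ≤ 2 * r) (by positivity : 0 < ε / 2)] with n hn h1
  have hlim := tendsto_integral_tailKernel hg.1 hm hB hr1 hn (hR n) x
  -- The estimate holds for all large `N` with `n` fixed, so it survives the passage to the full
  -- tail; `ε/2` leaves room for strict inequality.
  have h2 := le_of_tendsto (hlim.sub_const ((-1 : ℝ) ^ (r + 1) / (2 * (r : ℝ) * π) * (gr - gl))).abs
    (b := ε / 2) (by
      filter_upwards [h1] with N h1
      set I := ∫ u in (0 : ℝ)..π, (g (x + u) - g (x - u)) * tailKernel (2 * r) n N u
      have e : (-1 : ℝ) ^ (r + 1) / π * I - (-1 : ℝ) ^ (r + 1) / (2 * (r : ℝ) * π) * (gr - gl)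
          = (-1 : ℝ) ^ (r + 1) / π * (I - (gr - gl) / (2 * r : ℕ)) := by
        push_cast
        field_simp
      rw [e, abs_mul, abs_div, abs_pow, abs_neg, abs_one, one_pow, abs_of_pos pi_pos]
      calc 1 / π * |I - (gr - gl) / (2 * r : ℕ)| ≤ 1 * (ε / 2) := by
            refine mul_le_mul ?_ h1 (abs_nonneg _) zero_le_one
            rw [div_le_one pi_pos]
            linarith [pi_gt_three]
        _ = ε / 2 := one_mul _)
  rw [Real.dist_eq]
  linarith

lemma exists_isConjTail_of_mem {lam : ℕ → ℝ} (hlam : IsWatermanSeq lam) {g : ℝ → ℝ}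
    (hg : g ∈ LambdaBV lam) : ∃ R : ℕ → ℝ → ℝ, ∀ n, IsConjTail g n (R n) := by
  obtain ⟨B, hB⟩ := exists_abs_le hlam hg
  choose R hR using exists_isConjTail (memLp_two_of_bdd (aemeasurable_of_mem hlam hg) hB)
  exact ⟨R, hR⟩

/-! ### Comparison of `ΛBV` with `HBV` -/

/-- Abel's inequality, strengthened for the induction: the weighted sum dominates `y m` times the
plain partial sum. -/
lemma sum_range_mul_nonneg {y d : ℕ → ℝ} (hy : Antitone y) (hy0 : ∀ i, 0 ≤ y i)
    (hd : ∀ m, 0 ≤ ∑ i ∈ Finset.range m, d i) (m : ℕ) :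
    0 ≤ ∑ i ∈ Finset.range m, y i * d i := by
  have key : ∀ m, y m * ∑ i ∈ Finset.range m, d i ≤ ∑ i ∈ Finset.range m, y i * d i := by
    intro m
    induction m with
    | zero => simp
    | succ m ih =>
      have h1 := mul_le_mul_of_nonneg_right (hy m.le_succ) (hd (m + 1))
      rw [Finset.sum_range_succ] at h1 ⊢
      rw [Finset.sum_range_succ (fun i => y i * d i)]
      rw [mul_add (y m)] at h1
      exact h1.trans (by linarith)
  exact (mul_nonneg (hy0 m) (hd m)).trans (key m)

/-- If the partial sums of `1 / i` are dominated by those of `1 / λ_i`, then every function of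
bounded `Λ`-variation is of bounded harmonic variation. -/
lemma lambdaBV_subset_HBV {lam : ℕ → ℝ} {B : ℝ}
    (hB : ∀ N, ∑ i ∈ Finset.range N, 1 / ((i : ℝ) + 1) ≤ B * ∑ i ∈ Finset.range N, 1 / lam i)
    (hB0 : 0 ≤ B) : LambdaBV lam ⊆ HBV := by
  rintro f ⟨hper, C, hC⟩
  refine ⟨hper, B * C, fun m a b hab hdisj => ?_⟩
  set x : Fin m → ℝ := fun i => |f (b i) - f (a i)| with hx
  -- Arranging the increments in decreasing order maximises the harmonic sum and provides the
  -- antitone sequence to which Abel's inequality applies.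
  set σ := Tuple.sort (fun i => -x i) with hσ
  have hanti : Antitone (x ∘ σ) := fun i j hij => by
    have := Tuple.monotone_sort (fun i => -x i) hij
    simpa using this
  set w : Fin m → ℝ := fun i => 1 / ((i : ℝ) + 1) with hw
  have hwanti : Antitone w := fun i j hij => by
    have : ((i : ℕ) : ℝ) ≤ (j : ℕ) := by exact_mod_cast hij
    simp only [hw]
    gcongr
  have h1 : ∑ i, x i * w i ≤ ∑ i, x (σ i) * w i := by
    have := (hanti.monovary hwanti).sum_comp_perm_mul_le_sum_mul (σ := σ⁻¹)
    simpa using this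
  set Y : ℕ → ℝ := fun i => if h : i < m then x (σ ⟨i, h⟩) else 0 with hY
  have hY0 : ∀ i, 0 ≤ Y i := fun i => by
    simp only [hY]
    split_ifs
    · exact abs_nonneg _
    · exact le_rfl
  have hYanti : Antitone Y := fun i j hij => by
    by_cases hj : j < m
    · have hi : i < m := by omega
      simp only [hY, hi, hj, dif_pos]
      exact hanti (show (⟨i, hi⟩ : Fin m) ≤ ⟨j, hj⟩ from hij)
    · have : Y j = 0 := by simp [hY, hj]
      rw [this]
      exact hY0 i
  have h2 := sum_range_mul_nonneg hYanti hY0 (d := fun i => B * (1 / lam i) - 1 / ((i : ℝ) + 1))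
    (fun N => by
      rw [Finset.sum_sub_distrib, ← Finset.mul_sum]
      linarith [hB N]) m
  rw [← Fin.sum_univ_eq_sum_range (fun i => Y i * (B * (1 / lam i) - 1 / ((i : ℝ) + 1)))] at h2
  have hYσ : ∀ i : Fin m, Y i = x (σ i) := fun i => by simp [hY]
  simp only [hYσ, mul_sub, Finset.sum_sub_distrib] at h2
  have h3 := hC m (a ∘ σ) (b ∘ σ) (fun i => hab (σ i)) fun i j hij =>
    hdisj _ _ fun h => hij (σ.injective h)
  have h4 : ∑ i, x (σ i) * (B * (1 / lam i))
      = B * ∑ i : Fin m, |f ((b ∘ σ) i) - f ((a ∘ σ) i)| / lam i := by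
    rw [Finset.mul_sum]
    refine Finset.sum_congr rfl fun i _ => ?_
    simp only [hx, Function.comp_apply]
    ring
  have h5 : ∑ i : Fin m, |f (b i) - f (a i)| / ((i : ℝ) + 1) = ∑ i, x i * w i :=
    Finset.sum_congr rfl fun i _ => by simp only [hx, hw]; ring
  rw [h5]
  refine h1.trans (le_trans ?_ (mul_le_mul_of_nonneg_left h3 hB0))
  rw [← h4]
  linarith

/-- The open intervals between image endpoints are again disjoint, so comparing Lebesgue measures
replaces any ordering of the intervals. -/
lemma Monotone.sum_sub_le_of_disjoint {F : ℝ → ℝ} (hF : Monotone F) {c d : ℝ} {m : ℕ}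
    {a b : Fin m → ℝ} (hab : ∀ i, c ≤ a i ∧ a i ≤ b i ∧ b i ≤ d) (hcd : c ≤ d)
    (hdisj : ∀ i j, i ≠ j → Disjoint (Ioo (a i) (b i)) (Ioo (a j) (b j))) :
    ∑ i, (F (b i) - F (a i)) ≤ F d - F c := by
  have hd : Pairwise (Function.onFun Disjoint fun i => Ioo (F (a i)) (F (b i))) := by
    intro i j hij
    have := hdisj i j hij
    rw [Set.Ioo_disjoint_Ioo] at this
    simp only [Function.onFun]
    rw [Set.Ioo_disjoint_Ioo, ← hF.map_min, ← hF.map_max]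
    exact hF this
  have h1 : volume (⋃ i, Ioo (F (a i)) (F (b i))) ≤ volume (Icc (F c) (F d)) := by
    refine measure_mono (iUnion_subset fun i => ?_)
    exact Ioo_subset_Icc_self.trans (Icc_subset_Icc (hF (hab i).1) (hF (hab i).2.2))
  rw [MeasureTheory.measure_iUnion hd fun i => measurableSet_Ioo, tsum_fintype] at h1
  simp only [Real.volume_Ioo, Real.volume_Icc] at h1
  rw [← ENNReal.ofReal_sum_of_nonneg fun i _ => sub_nonneg.2 (hF (hab i).2.1)] at h1
  exact (ENNReal.ofReal_le_ofReal_iff (sub_nonneg.2 (hF hcd))).1 h1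

/-! ### Cosine waves and their resonance with the kernel -/

/-- The phase `(N + 1/2) t` cut off at `π / 2` from below and at its value at `π` from above. -/
noncomputable def cutPhase (N : ℕ) (t : ℝ) : ℝ :=
  max (π / 2) (min (((N : ℝ) + 1 / 2) * t) (((N : ℝ) + 1 / 2) * π))

/-- A `2π`-periodic cosine wave with `N` half-periods in `[0, π]`, vanishing elsewhere. -/
noncomputable def cosWave (N : ℕ) (t : ℝ) : ℝ :=
  Real.cos (cutPhase N (toIcoMod two_pi_pos 0 t))

lemma monotone_cutPhase (N : ℕ) : Monotone (cutPhase N) := fun s t hst => by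
  unfold cutPhase
  gcongr

lemma cos_phase_pi (N : ℕ) : Real.cos (((N : ℝ) + 1 / 2) * π) = 0 := by
  have : ((N : ℝ) + 1 / 2) * π = π / 2 + N * π := by ring
  rw [this, Real.cos_add_nat_mul_pi]
  simp

lemma half_pi_le_phase (N : ℕ) : π / 2 ≤ ((N : ℝ) + 1 / 2) * π := by
  have : 0 ≤ (N : ℝ) * π := by positivity
  linarith

lemma cutPhase_of_pi_le (N : ℕ) {t : ℝ} (ht : π ≤ t) :
    cutPhase N t = ((N : ℝ) + 1 / 2) * π := by
  unfold cutPhase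
  rw [min_eq_right (by gcongr), max_eq_right (half_pi_le_phase N)]

lemma cutPhase_zero (N : ℕ) : cutPhase N 0 = π / 2 := by
  unfold cutPhase
  rw [mul_zero, min_eq_left (by positivity), max_eq_left (by positivity)]

lemma cosWave_of_mem (N : ℕ) {t : ℝ} (ht : t ∈ Icc 0 (2 * π)) :
    cosWave N t = Real.cos (cutPhase N t) := by
  unfold cosWave
  rcases ht.2.eq_or_lt with rfl | hlt
  · have : toIcoMod two_pi_pos 0 (2 * π) = 0 := by
      have := toIcoMod_add_right two_pi_pos (0 : ℝ) 0
      rwa [zero_add, toIcoMod_apply_left] at this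
    rw [this, cutPhase_zero, cutPhase_of_pi_le N (by linarith [pi_pos]), cos_phase_pi]
    simp
  · rw [(toIcoMod_eq_self two_pi_pos).2 ⟨ht.1, by linarith⟩]

lemma periodic_cosWave (N : ℕ) : Function.Periodic (cosWave N) (2 * π) := fun t => by
  unfold cosWave
  rw [toIcoMod_add_right]

lemma abs_cosWave_le (N : ℕ) (t : ℝ) : |cosWave N t| ≤ 1 := Real.abs_cos_le_one _

lemma cosWave_neg (N : ℕ) {t : ℝ} (ht : t ∈ Icc 0 π) : cosWave N (-t) = 0 := by
  rw [← periodic_cosWave N, cosWave_of_mem N ⟨by linarith [ht.2, pi_pos], by linarith [ht.1]⟩,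
    cutPhase_of_pi_le N (by linarith [ht.2]), cos_phase_pi]

/-- The first `N` terms have increments at most 2. In the others the weight is at most `1/λ_N` (in
the indexing of `lam`), and the increments sum to at most `N * π`, since the cosine is 1-Lipschitz
and the phase is monotone. As `N/λ_N` is at most the sum of the first `N` weights, the constant is
`2 + π ≤ 6`. -/
lemma sum_abs_cosWave_le {lam : ℕ → ℝ} (hpos : ∀ i, 0 < lam i) (hmono : Monotone lam) (N : ℕ)
    {m : ℕ} {a b : Fin m → ℝ} (hab : ∀ i, 0 ≤ a i ∧ a i < b i ∧ b i ≤ 2 * π)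
    (hdisj : ∀ i j, i ≠ j → Disjoint (Ioo (a i) (b i)) (Ioo (a j) (b j))) :
    ∑ i, |cosWave N (b i) - cosWave N (a i)| / lam (i : ℕ)
      ≤ 6 * ∑ i ∈ Finset.range N, 1 / lam i := by
  set L := ∑ i ∈ Finset.range N, 1 / lam i with hL
  have hterm : ∀ i : Fin m, |cosWave N (b i) - cosWave N (a i)| / lam (i : ℕ)
      ≤ (if (i : ℕ) < N then 2 / lam i else 0)
        + (cutPhase N (b i) - cutPhase N (a i)) * (1 / lam N) := by
    intro i
    obtain ⟨h1, h2, h3⟩ := hab i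
    have hinc : 0 ≤ cutPhase N (b i) - cutPhase N (a i) := sub_nonneg.2 (monotone_cutPhase N h2.le)
    have hN := hpos N
    have hi := hpos i
    split_ifs with hiN
    · have : |cosWave N (b i) - cosWave N (a i)| ≤ 2 := by
        have e1 := abs_cosWave_le N (b i)
        have e2 := abs_cosWave_le N (a i)
        linarith [abs_sub (cosWave N (b i)) (cosWave N (a i))]
      have e3 : |cosWave N (b i) - cosWave N (a i)| / lam i ≤ 2 / lam i := by gcongr
      have : 0 ≤ (cutPhase N (b i) - cutPhase N (a i)) * (1 / lam N) := by positivity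
      linarith
    · rw [zero_add, mul_one_div]
      have hle : |cosWave N (b i) - cosWave N (a i)| ≤ cutPhase N (b i) - cutPhase N (a i) := by
        rw [cosWave_of_mem N ⟨by linarith, h3⟩, cosWave_of_mem N ⟨h1, by linarith⟩]
        exact (abs_cos_sub_cos_le _ _).trans_eq (abs_of_nonneg hinc)
      have := hmono (not_lt.1 hiN)
      gcongr
  refine (Finset.sum_le_sum fun i _ => hterm i).trans ?_
  rw [Finset.sum_add_distrib, ← Finset.sum_mul]
  have h1 : ∑ i : Fin m, (if (i : ℕ) < N then 2 / lam i else 0) ≤ 2 * L := by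
    rw [Fin.sum_univ_eq_sum_range (fun i => if i < N then 2 / lam i else 0), hL, Finset.mul_sum,
      ← Finset.sum_filter]
    calc _ ≤ ∑ i ∈ Finset.range N, 2 / lam i :=
          Finset.sum_le_sum_of_subset_of_nonneg (fun i hi => by
            simpa using (Finset.mem_filter.1 hi).2) fun i _ _ => by
              have := hpos i
              positivity
      _ = _ := Finset.sum_congr rfl fun i _ => by ring
  have h2 : ∑ i, (cutPhase N (b i) - cutPhase N (a i)) ≤ N * π := by
    refine ((monotone_cutPhase N).sum_sub_le_of_disjoint (c := 0) (d := 2 * π)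
      (fun i => ⟨(hab i).1, (hab i).2.1.le, (hab i).2.2⟩) two_pi_pos.le hdisj).trans ?_
    rw [cutPhase_zero, cutPhase_of_pi_le N (by linarith [pi_pos])]
    linarith
  have h3 : N * (1 / lam N) ≤ L := by
    have : ∑ i ∈ Finset.range N, 1 / lam N ≤ L := Finset.sum_le_sum fun i hi => by
      have := hpos i
      have := hmono (Finset.mem_range.1 hi).le
      gcongr
    simpa using this
  have hN := hpos N
  have h4 : (∑ i, (cutPhase N (b i) - cutPhase N (a i))) * (1 / lam N) ≤ N * π * (1 / lam N) := by
    gcongr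
  have h5 : 0 ≤ N * (1 / lam N) := by positivity
  nlinarith [pi_le_four, pi_pos]

lemma sum_by_parts_eq (w E : ℕ → ℝ) {n N : ℕ} (hnN : n ≤ N) :
    ∑ k ∈ Finset.Ico n N, w k * (E k - E (k + 1))
      = w n * E n - w N * E N - ∑ k ∈ Finset.Ico n N, (w k - w (k + 1)) * E (k + 1) := by
  induction N, hnN using Nat.le_induction with
  | base => simp
  | succ N hN ih => rw [Finset.sum_Ico_succ_top hN, Finset.sum_Ico_succ_top hN, ih]; ring

/-- Convexity of `k ↦ (n/k)^p`: it makes the differences of the weights monotone, as a second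
summation by parts requires. -/
lemma div_pow_convex (p n : ℕ) {k : ℕ} (hk : 1 ≤ k) :
    ((n : ℝ) / (k + 1 : ℕ)) ^ p - ((n : ℝ) / (k + 1 + 1 : ℕ)) ^ p
      ≤ ((n : ℝ) / k) ^ p - ((n : ℝ) / (k + 1 : ℕ)) ^ p := by
  have hk0 : (1 : ℝ) ≤ k := by exact_mod_cast hk
  have h := (convexOn_pow (𝕜 := ℝ) p).2 (x := (n : ℝ) / k) (y := (n : ℝ) / (k + 1 + 1 : ℕ))
    (by simp only [mem_Ici]; positivity) (by simp only [mem_Ici]; positivity)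
    (by norm_num : (0 : ℝ) ≤ 1 / 2) (by norm_num : (0 : ℝ) ≤ 1 / 2) (by norm_num)
  simp only [smul_eq_mul] at h
  have h2 : ((n : ℝ) / (k + 1 : ℕ)) ^ p
      ≤ (1 / 2 * ((n : ℝ) / k) + 1 / 2 * ((n : ℝ) / (k + 1 + 1 : ℕ))) ^ p := by
    gcongr
    push_cast
    have : 1 / 2 * ((n : ℝ) / k) + 1 / 2 * ((n : ℝ) / (k + 1 + 1))
        = n * ((k + 1) / (k * (k + 1 + 1))) := by field_simp; ring
    rw [this, div_eq_mul_one_div]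
    gcongr ?_ * ?_
    rw [div_le_div_iff₀ (by positivity) (by positivity)]
    nlinarith
  linarith

/-- Second order summation by parts for the kernel. -/
lemma abs_tailKernel_sub_le (p : ℕ) {n N : ℕ} (hn : 1 ≤ n) (hN : n ≤ N) {t : ℝ} (h0 : 0 < t)
    (hπ : t ≤ π) :
    |tailKernel p n N t - (Real.cos ((n - 1 / 2) * t) / (2 * Real.sin (t / 2))
      - ((n : ℝ) / N) ^ p * (Real.cos ((N - 1 / 2) * t) / (2 * Real.sin (t / 2))))|
      ≤ p / n * (π ^ 2 / (2 * t ^ 2)) := by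
  have hs := sin_half_pos h0 hπ
  have hn0 : (0 : ℝ) < n := by exact_mod_cast hn
  set w : ℕ → ℝ := fun k => ((n : ℝ) / k) ^ p with hw
  set E : ℕ → ℝ := fun k => Real.cos ((k - 1 / 2) * t) / (2 * Real.sin (t / 2)) with hE
  have hK : tailKernel p n N t = ∑ k ∈ Finset.Ico n N, w k * (E k - E (k + 1)) := by
    refine Finset.sum_congr rfl fun k _ => ?_
    simp only [hw, hE]
    rw [← sub_div, ← two_sin_half_mul_sin]
    field_simp
  have hwn : w n = 1 := div_self_pow p hn
  rw [hK, sum_by_parts_eq w E hN, hwn, one_mul]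
  -- `E` is itself a difference, which allows the second summation by parts.
  have hE' : ∀ k : ℕ, E (k + 1) = -Real.sin (k * t) / (4 * Real.sin (t / 2) ^ 2)
      - -Real.sin ((k + 1 : ℕ) * t) / (4 * Real.sin (t / 2) ^ 2) := by
    intro k
    have e1 : (((k + 1 : ℕ) : ℝ)) * t = (((k + 1 : ℕ) : ℝ) - 1 / 2) * t + t / 2 := by ring
    have e2 : (k : ℝ) * t = (((k + 1 : ℕ) : ℝ) - 1 / 2) * t - t / 2 := by push_cast; ring
    rw [e1, e2, Real.sin_add, Real.sin_sub]
    simp only [hE]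
    field_simp
    ring
  have hsum := abs_sum_by_parts_le (n := n) (w := fun k => w k - w (k + 1))
    (E := fun k => -Real.sin (k * t) / (4 * Real.sin (t / 2) ^ 2))
    (B := 1 / (4 * Real.sin (t / 2) ^ 2)) N
    (fun k hk => div_pow_convex p n (by omega))
    (fun k hk => sub_nonneg.2 (div_pow_antitone p hn k hk)) (fun k => by
      rw [abs_div, abs_neg, abs_of_pos (by positivity : 0 < 4 * Real.sin (t / 2) ^ 2)]
      gcongr
      exact Real.abs_sin_le_one _)
  simp only [← hE'] at hsum
  have hv : w n - w (n + 1) ≤ p / n := by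
    have hb := one_add_mul_le_pow (a := -(1 / ((n : ℝ) + 1))) (by
      have : 1 / ((n : ℝ) + 1) ≤ 1 := by rw [div_le_one (by positivity)]; linarith
      linarith) p
    have e : w (n + 1) = (1 + -(1 / ((n : ℝ) + 1))) ^ p := by
      simp only [hw]
      push_cast
      congr 1
      field_simp
      ring
    have : p * (1 / ((n : ℝ) + 1)) ≤ p / n := by
      rw [mul_one_div]; gcongr; linarith
    rw [e, hwn]
    linarith
  have e : ∀ X Y Z : ℝ, X - Y - Z - (X - Y) = -Z := fun X Y Z => by ring
  rw [e, abs_neg]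
  refine hsum.trans ?_
  have hsin : 1 / (4 * Real.sin (t / 2) ^ 2) ≤ π ^ 2 / (4 * t ^ 2) := by
    have := pow_le_pow_left₀ (by positivity) (one_div_sin_half_le h0 hπ) 2
    calc 1 / (4 * Real.sin (t / 2) ^ 2) = (1 / Real.sin (t / 2)) ^ 2 / 4 := by field_simp
      _ ≤ (π / t) ^ 2 / 4 := by gcongr
      _ = _ := by field_simp
  calc 2 * (1 / (4 * Real.sin (t / 2) ^ 2)) * (w n - w (n + 1))
      ≤ 2 * (π ^ 2 / (4 * t ^ 2)) * (p / n) := by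
        gcongr
        exact sub_nonneg.2 (div_pow_antitone p hn n le_rfl)
    _ = _ := by field_simp; ring

/-- The positive contribution of one wave to its resonating kernel. -/
lemma harmonic_le_integral_cos_sq (N : ℕ) :
    (∑ j ∈ Finset.range N, 1 / ((j : ℝ) + 1)) / 3
      ≤ ∫ t in (π / 2 / ((N : ℝ) + 1 / 2))..π, Real.cos (((N : ℝ) + 1 / 2) * t) ^ 2 / t := by
  set ω : ℝ := (N : ℝ) + 1 / 2 with hω
  have hω0 : 0 < ω := by positivity
  -- The zeros of `cos ωt`. Between consecutive ones `cos²` integrates to `π/(2ω)`, and `1/t ≥ 1/u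
  -- (j+1)` yields `1/(2j+3) ≥ 1/(3(j+1))`.
  set u : ℕ → ℝ := fun j => ((j : ℝ) + 1 / 2) * π / ω with hu
  have hu0 : u 0 = π / 2 / ω := by simp only [hu]; push_cast; ring
  have huN : u N = π := by simp only [hu, hω]; field_simp
  have hupos : ∀ j, 0 < u j := fun j => by simp only [hu]; positivity
  have hule : ∀ j, u j ≤ u (j + 1) := fun j => by
    simp only [hu]; push_cast; gcongr; linarith
  have hint : ∀ j, IntervalIntegrable (fun t => Real.cos (ω * t) ^ 2 / t) volume (u j)
      (u (j + 1)) := fun j => by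
    refine ContinuousOn.intervalIntegrable ?_
    rw [uIcc_of_le (hule j)]
    refine ContinuousOn.div (by fun_prop) (by fun_prop) fun t ht => ?_
    exact ((hupos j).trans_le ht.1).ne'
  rw [← hu0, ← huN, ← intervalIntegral.sum_integral_adjacent_intervals fun j _ => hint j, Finset.sum_div]
  refine Finset.sum_le_sum fun j _ => ?_
  have hsq : ∫ t in (u j)..(u (j + 1)), Real.cos (ω * t) ^ 2 = π / (2 * ω) := by
    have hc : ∀ j : ℕ, Real.cos (ω * u j) = 0 := fun j => by
      have : ω * u j = (j + 1 / 2) * π := by simp only [hu]; field_simp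
      rw [this, cos_phase_pi]
    rw [intervalIntegral.integral_comp_mul_left (fun t => Real.cos t ^ 2) hω0.ne', integral_cos_sq,
      hc, hc]
    simp only [hu, smul_eq_mul]
    push_cast
    field_simp
    ring
  calc 1 / ((j : ℝ) + 1) / 3 ≤ 1 / u (j + 1) * (π / (2 * ω)) := by
        simp only [hu]
        push_cast
        rw [div_div, one_div_div, div_mul_div_comm, div_le_div_iff₀ (by positivity) (by positivity)]
        have : 0 < ω * π := by positivity
        have hj : (0 : ℝ) ≤ j := Nat.cast_nonneg j
        nlinarith [mul_nonneg hj this.le]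
    _ = ∫ t in (u j)..(u (j + 1)), 1 / u (j + 1) * Real.cos (ω * t) ^ 2 := by
        rw [intervalIntegral.integral_const_mul, hsq]
    _ ≤ _ := by
        refine intervalIntegral.integral_mono_on (hule j)
          (Continuous.intervalIntegrable (by fun_prop) _ _) (hint j) fun t ht => ?_
        have ht0 := (hupos j).trans_le ht.1
        rw [one_div_mul_eq_div]
        have := ht.2
        gcongr

lemma integral_inv_sq {a b : ℝ} (ha : 0 < a) (hab : a ≤ b) :
    ∫ t in a..b, 1 / t ^ 2 = 1 / a - 1 / b := by
  have hne : ∀ t ∈ uIcc a b, t ≠ 0 := fun t ht => by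
    rw [uIcc_of_le hab] at ht
    exact (ha.trans_le ht.1).ne'
  rw [intervalIntegral.integral_eq_sub_of_hasDerivAt (f := fun t => -t⁻¹)
    (fun t ht => ((hasDerivAt_inv (hne t ht)).neg).congr_deriv (by simp))]
  · simp only [one_div]; ring
  · exact (ContinuousOn.div (by fun_prop) (by fun_prop)
      fun t ht => pow_ne_zero 2 (hne t ht)).intervalIntegrable

/-- With `n = N + 1` the leading part of the kernel is `cos((n - 1/2)t)/(2 sin(t/2))`, whose
frequency is exactly that of the wave, so the product is at least `cos²/t`. The upper index `n²`
gives the other boundary term weight at most `1/n`; it costs at most `π`, and the second order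
remainder at most `pπ`. -/
lemma le_integral_cosWave (p N : ℕ) (hp : 1 ≤ p) :
    (∑ j ∈ Finset.range N, 1 / ((j : ℝ) + 1)) / 3 - (p + 1) * π
      ≤ ∫ t in (0 : ℝ)..π, (cosWave N t - cosWave N (-t))
          * tailKernel p (N + 1) ((N + 1) * (N + 1)) t := by
  set ω : ℝ := (N : ℝ) + 1 / 2 with hω
  have hω0 : 0 < ω := by positivity
  set a : ℝ := π / 2 / ω with ha
  have ha0 : 0 < a := by positivity
  have haπ : a ≤ π := by
    rw [ha, div_le_iff₀ hω0]
    have := half_pi_le_phase N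
    rwa [mul_comm π]
  set K := tailKernel p (N + 1) ((N + 1) * (N + 1)) with hKdef
  have hK : Continuous K := continuous_tailKernel _ _ _
  have hwave : ∀ t ∈ Icc 0 π, cosWave N t - cosWave N (-t) = Real.cos (cutPhase N t) :=
    fun t ht => by
      rw [cosWave_neg N ht, cosWave_of_mem N ⟨ht.1, by linarith [ht.2, pi_pos]⟩, sub_zero]
  have hcut : Continuous (cutPhase N) := by unfold cutPhase; fun_prop
  have e1 : ∫ t in (0 : ℝ)..π, (cosWave N t - cosWave N (-t)) * K t
      = ∫ t in (0 : ℝ)..π, Real.cos (cutPhase N t) * K t := by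
    refine intervalIntegral.integral_congr fun t ht => ?_
    rw [uIcc_of_le pi_pos.le] at ht
    simp only [hwave t ht]
  have hcont : Continuous fun t => Real.cos (cutPhase N t) * K t := by fun_prop
  have e2 : ∫ t in (0 : ℝ)..a, Real.cos (cutPhase N t) * K t = 0 := by
    rw [intervalIntegral.integral_congr (g := fun _ => 0), intervalIntegral.integral_zero]
    intro t ht
    rw [uIcc_of_le ha0.le] at ht
    have h1 : ω * t ≤ π / 2 := by
      have := ht.2
      rw [ha, le_div_iff₀ hω0] at this
      linarith
    have : cutPhase N t = π / 2 := by
      unfold cutPhase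
      exact max_eq_left ((min_le_left _ _).trans h1)
    simp only [this, Real.cos_pi_div_two, zero_mul]
  have e3 : ∫ t in a..π, Real.cos (cutPhase N t) * K t = ∫ t in a..π, Real.cos (ω * t) * K t := by
    refine intervalIntegral.integral_congr fun t ht => ?_
    rw [uIcc_of_le haπ] at ht
    have h1 : π / 2 ≤ ω * t := by
      have := ht.1
      rw [ha, div_le_iff₀ hω0] at this
      linarith
    have : cutPhase N t = ω * t := by
      unfold cutPhase
      rw [min_eq_left (mul_le_mul_of_nonneg_left ht.2 hω0.le), max_eq_right h1]
    simp only [this]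
  rw [e1, ← intervalIntegral.integral_add_adjacent_intervals (hcont.intervalIntegrable 0 a)
    (hcont.intervalIntegrable a π), e2, e3, zero_add]
  set n : ℝ := (N : ℝ) + 1 with hn
  have hn1 : 1 ≤ n := by rw [hn]; linarith [(Nat.cast_nonneg N : (0 : ℝ) ≤ N)]
  have hωn : ω ≤ n := by rw [hω, hn]; linarith
  have hpoint : ∀ t ∈ Icc a π, Real.cos (ω * t) ^ 2 / t - (1 / n * (π / (2 * a))
      + p / n * (π ^ 2 / 2) * (1 / t ^ 2)) ≤ Real.cos (ω * t) * K t := by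
    intro t ht
    have ht0 := ha0.trans_le ht.1
    have h := abs_tailKernel_sub_le p (n := N + 1) (N := (N + 1) * (N + 1)) (by omega)
      (by nlinarith) ht0 ht.2
    have c1 : ((N + 1 : ℕ) : ℝ) = n := by push_cast; rfl
    have c2 : (((N + 1) * (N + 1) : ℕ) : ℝ) = n * n := by push_cast; rfl
    rw [c1, c2] at h
    have c3 : n - 1 / 2 = ω := by rw [hn, hω]; ring
    rw [c3] at h
    set c := Real.cos (ω * t) with hc
    have hc1 : |c| ≤ 1 := Real.abs_cos_le_one _
    have hs := sin_half_pos ht0 ht.2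
    set D := Real.cos ((n * n - 1 / 2) * t) / (2 * Real.sin (t / 2)) with hD
    have hD1 : |D| ≤ π / (2 * a) := by
      refine (abs_div_two_sin_half_le ht0 ht.2 (Real.abs_cos_le_one _)).trans ?_
      have := one_div_sin_half_le ht0 ht.2
      calc 1 / (2 * Real.sin (t / 2)) = (1 / Real.sin (t / 2)) / 2 := by field_simp
        _ ≤ (π / t) / 2 := by gcongr
        _ = π / (2 * t) := by field_simp
        _ ≤ π / (2 * a) := by have := ht.1; gcongr
    have hw : (n / (n * n)) ^ p ≤ 1 / n := by
      have : n / (n * n) = 1 / n := by field_simp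
      rw [this]
      exact pow_le_of_le_one (by positivity) ((div_le_one (by linarith)).2 hn1) (by omega)
    have hwD : |c * ((n / (n * n)) ^ p * D)| ≤ 1 / n * (π / (2 * a)) := by
      rw [abs_mul, abs_mul, abs_of_nonneg (by positivity : 0 ≤ (n / (n * n)) ^ p)]
      calc |c| * ((n / (n * n)) ^ p * |D|) ≤ 1 * (1 / n * (π / (2 * a))) := by gcongr
        _ = _ := one_mul _
    have hmain : c ^ 2 / t ≤ c * (c / (2 * Real.sin (t / 2))) := by
      have : c * (c / (2 * Real.sin (t / 2))) = c ^ 2 / (2 * Real.sin (t / 2)) := by ring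
      rw [this]
      have hst : Real.sin (t / 2) ≤ t / 2 := Real.sin_le (by linarith)
      have : 2 * Real.sin (t / 2) ≤ t := by linarith
      gcongr
    have herr : |c * (K t - (c / (2 * Real.sin (t / 2)) - (n / (n * n)) ^ p * D))|
        ≤ p / n * (π ^ 2 / 2) * (1 / t ^ 2) := by
      rw [abs_mul]
      calc _ ≤ 1 * (p / n * (π ^ 2 / (2 * t ^ 2))) := by gcongr
        _ = _ := by field_simp
    rw [abs_le] at hwD herr
    linarith [hwD.1, hwD.2, herr.1, herr.2]
  have hne : ∀ t ∈ uIcc a π, t ≠ 0 := fun t ht => by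
    rw [uIcc_of_le haπ] at ht
    exact (ha0.trans_le ht.1).ne'
  have i1 : IntervalIntegrable (fun t => Real.cos (ω * t) ^ 2 / t) volume a π :=
    (ContinuousOn.div (by fun_prop) (by fun_prop) hne).intervalIntegrable
  have i2 : IntervalIntegrable (fun t => p / n * (π ^ 2 / 2) * (1 / t ^ 2)) volume a π :=
    (ContinuousOn.mul continuousOn_const (ContinuousOn.div (by fun_prop) (by fun_prop)
      fun t ht => pow_ne_zero 2 (hne t ht))).intervalIntegrable
  have hle := intervalIntegral.integral_mono_on haπ
    (i1.sub (intervalIntegrable_const.add i2))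
    (Continuous.intervalIntegrable (by fun_prop) _ _) hpoint
  refine le_trans ?_ hle
  rw [intervalIntegral.integral_sub i1 (intervalIntegrable_const.add i2),
    intervalIntegral.integral_add intervalIntegrable_const i2, intervalIntegral.integral_const,
    intervalIntegral.integral_const_mul, integral_inv_sq ha0 haπ, smul_eq_mul]
  have hH := harmonic_le_integral_cos_sq N
  rw [← hω, ← ha] at hH
  have hinva : 1 / a = 2 * ω / π := by rw [ha]; field_simp
  have b1 : (π - a) * (1 / n * (π / (2 * a))) ≤ π := by
    have e : 1 / n * (π / (2 * a)) = ω / n := by rw [ha]; field_simp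
    rw [e]
    calc (π - a) * (ω / n) ≤ π * 1 := by
          gcongr
          · linarith
          · exact (div_le_one (by linarith)).2 hωn
      _ = π := mul_one π
  have b2 : p / n * (π ^ 2 / 2) * (1 / a - 1 / π) ≤ p * π := by
    calc p / n * (π ^ 2 / 2) * (1 / a - 1 / π) ≤ p / n * (π ^ 2 / 2) * (2 * ω / π) := by
          rw [hinva]
          gcongr
          have : 0 < 1 / π := by positivity
          linarith
      _ = p * π * (ω / n) := by field_simp
      _ ≤ p * π * 1 := by
          gcongr
          exact (div_le_one (by linarith)).2 hωn
      _ = p * π := mul_one _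
  linarith

/-! ### Condensation of singularities and `ℓ¹` superpositions -/

/-- Condensation of singularities for countably many families of functionals. -/
lemma exists_forall_unbounded {X ι : Type*} [NormedAddCommGroup X] [NormedSpace ℝ X]
    [CompleteSpace X] (T : ℕ → ι → X →L[ℝ] ℝ)
    (hT : ∀ r, ∀ m : ℝ, ∃ i x, ‖x‖ ≤ 1 ∧ m < |T r i x|) :
    ∃ x, ∀ r, ∀ m : ℝ, ∃ i, m < |T r i x| := by
  by_contra! hcon
  obtain ⟨q, hq⟩ := nonempty_interior_of_iUnion_of_closed
    (f := fun q : ℕ × ℕ => {x : X | ∀ i, |T q.1 i x| ≤ q.2})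
    (fun q => by
      simp only [Set.ofPred_forall]
      exact isClosed_iInter fun i => isClosed_le (T q.1 i).continuous.abs continuous_const)
    (by
      refine eq_univ_of_forall fun x => ?_
      obtain ⟨r, m, h⟩ := hcon x
      obtain ⟨M, hM⟩ := exists_nat_ge m
      exact mem_iUnion.2 ⟨(r, M), fun i => (h i).trans hM⟩)
  obtain ⟨x₀, hx₀⟩ := hq
  obtain ⟨ε, hε, hball⟩ := Metric.isOpen_iff.1 isOpen_interior x₀ hx₀
  -- Both `x₀` and `x₀ + (ε/2) y` lie in the closed set, so `(ε/2)|T y| ≤ 2 q.2`; the threshold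
  -- contradicts exactly this.
  obtain ⟨i, y, hy, hlt⟩ := hT q.1 (4 * q.2 / ε)
  have h0 : |T q.1 i x₀| ≤ q.2 := interior_subset hx₀ i
  have h1 : |T q.1 i (x₀ + (ε / 2) • y)| ≤ q.2 := by
    refine interior_subset (hball ?_) i
    rw [Metric.mem_ball, dist_self_add_left, norm_smul, Real.norm_of_nonneg (by positivity)]
    calc ε / 2 * ‖y‖ ≤ ε / 2 * 1 := by gcongr
      _ < ε := by linarith
  rw [map_add, map_smul, smul_eq_mul] at h1
  have h2 : |ε / 2 * T q.1 i y| ≤ 2 * q.2 := by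
    rw [abs_le] at *
    constructor <;> linarith [h0.1, h0.2, h1.1, h1.2]
  rw [abs_mul, abs_of_pos (by positivity)] at h2
  rw [div_lt_iff₀ hε] at hlt
  linarith

section Superposition

/-- The space of absolutely summable real sequences. -/
abbrev EllOne : Type := lp (fun _ : ℕ => ℝ) 1

lemma lp_one_summable (c : EllOne) : Summable fun k => |c k| := by
  simpa using (lp.memℓp c).summable (by simp)

lemma lp_one_norm (c : EllOne) : ‖c‖ = ∑' k, |c k| := by
  simpa using lp.norm_eq_tsum_rpow (by simp) c

/-- The superposition `∑ c_k φ_k`. -/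
noncomputable def superpose (φ : ℕ → ℝ → ℝ) (c : EllOne) (t : ℝ) : ℝ := ∑' k, c k * φ k t

variable {φ : ℕ → ℝ → ℝ} {B : ℝ}

lemma summable_mul_of_bdd (c : EllOne) {v : ℕ → ℝ} (hv : ∀ k, |v k| ≤ B) :
    Summable (fun k => c k * v k) ∧ |∑' k, c k * v k| ≤ B * ‖c‖ := by
  have hs := (lp_one_summable c).mul_left B
  have hle : ∀ k, ‖c k * v k‖ ≤ B * |c k| := fun k => by
    rw [norm_mul, mul_comm]
    exact mul_le_mul_of_nonneg_right (hv k) (abs_nonneg _)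
  refine ⟨hs.of_norm_bounded hle, ?_⟩
  rw [lp_one_norm, ← tsum_mul_left]
  exact tsum_of_norm_bounded hs.hasSum hle

lemma superpose_add (hB : ∀ k t, |φ k t| ≤ B) (c d : EllOne) (t : ℝ) :
    superpose φ (c + d) t = superpose φ c t + superpose φ d t := by
  unfold superpose
  rw [← ((summable_mul_of_bdd c fun k => hB k t).1).tsum_add
    (summable_mul_of_bdd d fun k => hB k t).1]
  exact tsum_congr fun k => by rw [lp.coeFn_add, Pi.add_apply, add_mul]

lemma superpose_smul (a : ℝ) (c : EllOne) (t : ℝ) :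
    superpose φ (a • c) t = a * superpose φ c t := by
  unfold superpose
  rw [← tsum_mul_left]
  exact tsum_congr fun k => by rw [lp.coeFn_smul, Pi.smul_apply, smul_eq_mul, mul_assoc]

lemma abs_superpose_le (hB : ∀ k t, |φ k t| ≤ B) (c : EllOne) (t : ℝ) :
    |superpose φ c t| ≤ B * ‖c‖ := (summable_mul_of_bdd c fun k => hB k t).2

lemma superpose_single (k : ℕ) (t : ℝ) :
    superpose φ (lp.single 1 k (1 : ℝ)) t = φ k t := by
  unfold superpose
  rw [tsum_eq_single k fun j hj => by rw [lp.single_apply_ne _ _ _ hj, zero_mul]]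
  rw [lp.single_apply_self, one_mul]

/-- For each fixed system of intervals the variation sum is a seminorm, at most 1 on every `φ k`;
hence it is at most `‖c‖` on the superposition. -/
lemma superpose_mem {lam : ℕ → ℝ} (hpos : ∀ i, 0 < lam i) (hB : ∀ k t, |φ k t| ≤ B)
    (hper : ∀ k, Function.Periodic (φ k) (2 * π))
    (hvar : ∀ (k m : ℕ) (a b : Fin m → ℝ), (∀ i, 0 ≤ a i ∧ a i < b i ∧ b i ≤ 2 * π) →
      (∀ i j, i ≠ j → Disjoint (Ioo (a i) (b i)) (Ioo (a j) (b j))) →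
      ∑ i, |φ k (b i) - φ k (a i)| / lam (i : ℕ) ≤ 1) (c : EllOne) :
    superpose φ c ∈ LambdaBV lam := by
  refine ⟨fun t => by simp only [superpose, fun k => hper k t], ‖c‖, fun m a b hab hdisj => ?_⟩
  have hd : ∀ k i, |φ k (b i) - φ k (a i)| ≤ 2 * B := fun k i => by
    linarith [abs_sub (φ k (b i)) (φ k (a i)), hB k (b i), hB k (a i)]
  have hs : ∀ i : Fin m, Summable fun k => |c k| * (|φ k (b i) - φ k (a i)| / lam i) := fun i => by
    refine ((lp_one_summable c).mul_right (2 * B / lam i)).of_nonneg_of_le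
      (fun k => mul_nonneg (abs_nonneg _) (div_nonneg (abs_nonneg _) (hpos _).le)) fun k => ?_
    exact mul_le_mul_of_nonneg_left (div_le_div_of_nonneg_right (hd k i) (hpos _).le)
      (abs_nonneg _)
  have hterm : ∀ i : Fin m, |superpose φ c (b i) - superpose φ c (a i)| / lam i
      ≤ ∑' k, |c k| * (|φ k (b i) - φ k (a i)| / lam i) := by
    intro i
    have h1 := (summable_mul_of_bdd c fun k => hB k (b i)).1
    have h2 := (summable_mul_of_bdd c fun k => hB k (a i)).1
    unfold superpose
    rw [← h1.tsum_sub h2, div_le_iff₀ (hpos _), ← tsum_mul_right, ← Real.norm_eq_abs]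
    refine tsum_of_norm_bounded ((hs i).mul_right _).hasSum fun k => le_of_eq ?_
    rw [← mul_sub, norm_mul, Real.norm_eq_abs, Real.norm_eq_abs]
    have := (hpos i).ne'
    field_simp
  refine (Finset.sum_le_sum fun i _ => hterm i).trans ?_
  rw [← Summable.tsum_finsetSum fun i _ => hs i, lp_one_norm]
  refine Summable.tsum_le_tsum (fun k => ?_) (summable_sum fun i _ => hs i) (lp_one_summable c)
  rw [← Finset.mul_sum]
  exact mul_le_of_le_one_right (abs_nonneg _) (hvar k m a b hab hdisj)

/-- The pairing of a superposition with a kernel, as a functional of the coefficients. -/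
lemma exists_kernel_functional (hB : ∀ k t, |φ k t| ≤ B)
    (hm : ∀ c, AEMeasurable (superpose φ c) volume) {K : ℝ → ℝ} (hK : Continuous K) :
    ∃ T : EllOne →L[ℝ] ℝ, ∀ c, T c
      = ∫ t in (0 : ℝ)..π, (superpose φ c t - superpose φ c (-t)) * K t := by
  have hint : ∀ c, IntervalIntegrable (fun t => (superpose φ c t - superpose φ c (-t)) * K t)
      volume 0 π := fun c => by
    obtain ⟨h1, h2⟩ := intervalIntegrable_symm (hm c) (abs_superpose_le hB c) 0 0 π
    simp only [zero_add, zero_sub] at h1 h2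
    exact (h1.sub h2).mul_continuousOn hK.continuousOn
  obtain ⟨D, hD⟩ := isCompact_Icc.exists_bound_of_continuousOn (s := Icc 0 π) hK.continuousOn
  refine ⟨LinearMap.mkContinuous
    { toFun := fun c => ∫ t in (0 : ℝ)..π, (superpose φ c t - superpose φ c (-t)) * K t
      map_add' := fun c d => ?_
      map_smul' := fun a c => ?_ } (2 * B * D * π) fun c => ?_, fun c => rfl⟩
  · rw [← intervalIntegral.integral_add (hint c) (hint d)]
    congr 1
    funext t
    rw [superpose_add hB, superpose_add hB]
    ring
  · rw [RingHom.id_apply, smul_eq_mul, ← intervalIntegral.integral_const_mul]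
    congr 1
    funext t
    rw [superpose_smul, superpose_smul]
    ring
  · have := intervalIntegral.norm_integral_le_of_norm_le_const (a := 0) (b := π)
      (f := fun t => (superpose φ c t - superpose φ c (-t)) * K t) (C := 2 * (B * ‖c‖) * D)
      (fun t ht => by
        rw [uIoc_of_le pi_pos.le] at ht
        rw [norm_mul, Real.norm_eq_abs]
        have h1 := abs_superpose_le hB c t
        have h2 := abs_superpose_le hB c (-t)
        have h3 := abs_sub (superpose φ c t) (superpose φ c (-t))
        exact mul_le_mul (by linarith) (hD t (Ioc_subset_Icc_self ht)) (norm_nonneg _)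
          (by linarith [abs_nonneg (superpose φ c t)]))
    refine this.trans (le_of_eq ?_)
    rw [sub_zero, abs_of_pos pi_pos]
    ring

end Superposition

/-! ### Unbounded tails and the failure of the jump formula -/

/-- The rest of the kernel is a rescaled kernel of order `N`, so a finite section is a combination
of two full tails. -/
lemma tailKernel_split {p n N N' : ℕ} (hn : 1 ≤ n) (hN : n ≤ N) (hN' : N ≤ N') (t : ℝ) :
    tailKernel p n N' t = tailKernel p n N t + ((n : ℝ) / N) ^ p * tailKernel p N N' t := by
  unfold tailKernel
  rw [← Finset.sum_Ico_consecutive _ hN hN', Finset.mul_sum]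
  congr 1
  refine Finset.sum_congr rfl fun k _ => ?_
  have : (N : ℝ) ≠ 0 := by exact_mod_cast (by omega : N ≠ 0)
  rw [← mul_assoc, ← mul_pow]
  congr 2
  field_simp

/-- Convergence of the scaled tails bounds all finite sections. -/
lemma exists_abs_integral_tailKernel_le {g : ℝ → ℝ} {B : ℝ} (hper : Function.Periodic g (2 * π))
    (hm : AEMeasurable g volume) (hB : ∀ x, |g x| ≤ B) {r : ℕ} (hr : 1 ≤ r) {R : ℕ → ℝ → ℝ}
    (hR : ∀ n, IsConjTail g n (R n)) {L : ℝ}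
    (hL : Tendsto (fun n : ℕ => (n : ℝ) ^ (2 * r) * iteratedPrimitive (2 * r) (R n) 0) atTop
      (𝓝 L)) :
    ∃ m, ∀ n N, 1 ≤ n → |∫ t in (0 : ℝ)..π, (g t - g (-t)) * tailKernel (2 * r) n N t| ≤ m := by
  set A : ℕ → ℝ := fun n => (n : ℝ) ^ (2 * r) * iteratedPrimitive (2 * r) (R n) 0 with hA
  obtain ⟨m, hm0⟩ := (Metric.isBounded_range_of_tendsto A hL).exists_norm_le
  have hAm : ∀ n, |A n| ≤ m := fun n => hm0 _ (mem_range_self n)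
  have hm00 : 0 ≤ m := (abs_nonneg _).trans (hAm 0)
  refine ⟨π * (2 * m), fun n N hn => ?_⟩
  rcases le_or_gt n N with hN | hN
  swap
  · simp only [tailKernel, Finset.Ico_eq_empty_of_le hN.le, Finset.sum_empty, mul_zero,
      intervalIntegral.integral_zero, abs_zero]
    positivity
  obtain ⟨h1, h2⟩ := intervalIntegrable_symm hm hB 0 0 π
  simp only [zero_add, zero_sub] at h1 h2
  have hint : ∀ n N, IntervalIntegrable (fun t => (g t - g (-t)) * tailKernel (2 * r) n N t)
      volume 0 π := fun n N =>
    (h1.sub h2).mul_continuousOn (continuous_tailKernel _ _ _).continuousOn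
  set s : ℝ := (-1) ^ (r + 1) / π with hs
  set q : ℝ := ((n : ℝ) / N) ^ (2 * r) with hq
  have hlim : ∀ n, 1 ≤ n → Tendsto (fun N => s * ∫ t in (0 : ℝ)..π,
      (g t - g (-t)) * tailKernel (2 * r) n N t) atTop (𝓝 (A n)) := fun n hn => by
    simpa using tendsto_integral_tailKernel hper hm hB hr hn (hR n) 0
  -- Letting `N' → ∞` in the splitting; as `|q| ≤ 1`, the section is controlled by two terms of the
  -- bounded sequence `A`.
  have e1 : A n = s * (∫ t in (0 : ℝ)..π, (g t - g (-t)) * tailKernel (2 * r) n N t) + q * A N := by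
    refine tendsto_nhds_unique (hlim n hn)
      ((((hlim N (by omega)).const_mul q).const_add _).congr' ?_)
    filter_upwards [eventually_ge_atTop N] with N' hN'
    have : ∀ t, (g t - g (-t)) * tailKernel (2 * r) n N' t
        = (g t - g (-t)) * tailKernel (2 * r) n N t
          + q * ((g t - g (-t)) * tailKernel (2 * r) N N' t) := fun t => by
      rw [tailKernel_split hn hN hN']; ring
    simp_rw [this]
    rw [intervalIntegral.integral_add (hint _ _) ((hint _ _).const_mul q),
      intervalIntegral.integral_const_mul]
    ring
  have hq1 : |q| ≤ 1 := by
    have hN0 : (0 : ℝ) < N := by exact_mod_cast (by omega : 0 < N)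
    rw [abs_of_nonneg (by positivity)]
    exact pow_le_one₀ (by positivity) ((div_le_one hN0).2 (by exact_mod_cast hN))
  set I := ∫ t in (0 : ℝ)..π, (g t - g (-t)) * tailKernel (2 * r) n N t
  have e2 : |s * I| ≤ 2 * m := by
    have : s * I = A n - q * A N := by linarith
    rw [this]
    have h3 : |q * A N| ≤ m := by
      rw [abs_mul]
      calc |q| * |A N| ≤ 1 * m := by gcongr; exact hAm N
        _ = m := one_mul m
    linarith [abs_sub (A n) (q * A N), hAm n]
  have hsabs : |s| = 1 / π := by
    rw [hs, abs_div, abs_pow, abs_neg, abs_one, one_pow, abs_of_pos pi_pos]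
  rw [abs_mul, hsabs, one_div_mul_eq_div, div_le_iff₀ pi_pos] at e2
  linarith

/-- If `ΛBV` is strictly larger than `HBV`, it contains a function all of whose scaled tails are
unbounded at the origin. -/
lemma exists_unbounded_tails {lam : ℕ → ℝ} (hlam : IsWatermanSeq lam)
    (hnot : ¬ LambdaBV lam ⊆ HBV) :
    ∃ g ∈ LambdaBV lam, ∀ r : ℕ, 1 ≤ r → ∀ m : ℝ, ∃ n N, 1 ≤ n ∧
      m < |∫ t in (0 : ℝ)..π, (g t - g (-t)) * tailKernel (2 * r) n N t| := by
  have hpos := hlam.pos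
  have hl0 := hpos 0
  have hH : ∀ B : ℝ, 0 ≤ B → ∃ N, B * ∑ i ∈ Finset.range N, 1 / lam i
      < ∑ i ∈ Finset.range N, 1 / ((i : ℝ) + 1) := by
    intro B hB
    by_contra! h
    exact hnot (lambdaBV_subset_HBV h hB)
  set S : ℕ → ℝ := fun N => ∑ i ∈ Finset.range N, 1 / lam i with hS
  have hSlow : ∀ k, 1 / lam 0 ≤ S (k + 1) := fun k => by
    simp only [hS]
    rw [Finset.sum_range_succ']
    have : 0 ≤ ∑ i ∈ Finset.range k, 1 / lam (i + 1) :=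
      Finset.sum_nonneg fun i _ => (one_div_pos.2 (hpos _)).le
    linarith
  have hSpos : ∀ k, 0 < S (k + 1) := fun k => (one_div_pos.2 hl0).trans_le (hSlow k)
  -- Normalises the wave with `k + 1` half-periods to `Λ`-variation at most 1; the shift avoids the
  -- empty sum `S 0 = 0`.
  set h : ℕ → ℝ := fun k => 1 / (6 * S (k + 1)) with hh
  have hhpos : ∀ k, 0 < h k := fun k => by
    have := hSpos k
    simp only [hh]
    positivity
  have hhle : ∀ k, h k ≤ lam 0 / 6 := fun k => by
    have h1 := hSlow k
    have h2 := hSpos k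
    simp only [hh]
    rw [div_le_iff₀ hl0] at h1
    rw [div_le_div_iff₀ (by positivity) (by norm_num)]
    linarith
  set φ : ℕ → ℝ → ℝ := fun k t => h k * cosWave (k + 1) t with hφ
  have hB : ∀ k t, |φ k t| ≤ lam 0 / 6 := fun k t => by
    simp only [hφ]
    rw [abs_mul, abs_of_pos (hhpos k)]
    calc h k * |cosWave (k + 1) t| ≤ lam 0 / 6 * 1 :=
          mul_le_mul (hhle k) (abs_cosWave_le _ _) (abs_nonneg _) (by positivity)
      _ = _ := mul_one _
  have hmem : ∀ c, superpose φ c ∈ LambdaBV lam := fun c => by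
    refine superpose_mem hpos hB (fun k t => ?_) (fun k m a b hab hdisj => ?_) c
    · simp only [hφ, periodic_cosWave (k + 1) t]
    · have h1 := sum_abs_cosWave_le hpos hlam.mono (k + 1) hab hdisj
      have h2 : ∀ i : Fin m, |φ k (b i) - φ k (a i)| / lam i
          = h k * (|cosWave (k + 1) (b i) - cosWave (k + 1) (a i)| / lam i) := fun i => by
        simp only [hφ]
        rw [← mul_sub, abs_mul, abs_of_pos (hhpos k), mul_div_assoc]
      simp only [h2]
      rw [← Finset.mul_sum]
      calc _ ≤ h k * (6 * S (k + 1)) := mul_le_mul_of_nonneg_left h1 (hhpos k).le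
        _ = 1 := by
          have := (hSpos k).ne'
          simp only [hh]
          field_simp
  have hT : ∀ (r : ℕ) (i : ℕ × ℕ), ∃ T : lp (fun _ : ℕ => ℝ) 1 →L[ℝ] ℝ, ∀ c, T c
      = ∫ t in (0 : ℝ)..π, (superpose φ c t - superpose φ c (-t))
          * tailKernel (2 * (r + 1)) (i.1 + 1) i.2 t := fun r i =>
    exists_kernel_functional hB (fun c => aemeasurable_of_mem hlam (hmem c))
      (continuous_tailKernel _ _ _)
  choose T hT using hT
  obtain ⟨c, hc⟩ := exists_forall_unbounded T fun r m => by
    set p := 2 * (r + 1) with hp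
    -- Since `h k * S (k + 1) = 1/6`, the factor `18 = 6 · 3` compensates both this and the 3 in
    -- `le_integral_cosWave`. The second summand absorbs the error `(p + 1)π`, scaled by `h k ≤ lam
    -- 0 / 6`.
    obtain ⟨N, hN⟩ := hH (18 * (|m| + (p + 1) * π * (lam 0 / 6))) (by positivity)
    rcases N with - | k
    · simp at hN
    refine ⟨(k + 1, (k + 2) * (k + 2)), lp.single 1 k 1, ?_, ?_⟩
    · rw [lp.norm_single (by simp)]; simp
    · rw [hT]
      simp only [superpose_single]
      have h1 := le_integral_cosWave p (k + 1) (by omega)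
      have h2 : ∀ t, (φ k t - φ k (-t)) * tailKernel p (k + 1 + 1) ((k + 2) * (k + 2)) t
          = h k * ((cosWave (k + 1) t - cosWave (k + 1) (-t))
            * tailKernel p (k + 1 + 1) ((k + 1 + 1) * (k + 1 + 1)) t) := fun t => by
        simp only [hφ]; ring
      simp only [← hp, h2]
      rw [intervalIntegral.integral_const_mul]
      refine lt_of_lt_of_le ?_ (le_abs_self _)
      refine lt_of_lt_of_le ?_ (mul_le_mul_of_nonneg_left h1 (hhpos k).le)
      have h3 := mul_lt_mul_of_pos_left hN (hhpos k)
      have h4 : h k * (18 * (|m| + (p + 1) * π * (lam 0 / 6)) * S (k + 1))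
          = 3 * (|m| + (p + 1) * π * (lam 0 / 6)) := by
        have := (hSpos k).ne'
        simp only [hh]
        field_simp
        ring
      have h5 : h k * ((p + 1) * π) ≤ lam 0 / 6 * ((p + 1) * π) :=
        mul_le_mul_of_nonneg_right (hhle k) (by positivity)
      rw [h4] at h3
      linarith [le_abs_self m]
  refine ⟨superpose φ c, hmem c, fun r hr m => ?_⟩
  obtain ⟨r, rfl⟩ : ∃ r', r = r' + 1 := ⟨r - 1, by omega⟩
  obtain ⟨i, hi⟩ := hc r m
  rw [hT] at hi
  exact ⟨i.1 + 1, i.2, by omega, hi⟩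

theorem mainTheorem3 :
    -- (a) the jump formula on `HBV`
    (∀ g ∈ HBV, ∀ r : ℕ, 1 ≤ r → ∀ x₀ : ℝ,
      ∃ gl gr : ℝ, Tendsto g (𝓝[<] x₀) (𝓝 gl) ∧ Tendsto g (𝓝[>] x₀) (𝓝 gr) ∧
        (∃ R : ℕ → ℝ → ℝ, ∀ n, IsConjTail g n (R n)) ∧
        ∀ R : ℕ → ℝ → ℝ, (∀ n, IsConjTail g n (R n)) →
          Tendsto (fun n : ℕ => (n : ℝ) ^ (2 * r) * iteratedPrimitive (2 * r) (R n) x₀) atTop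
            (𝓝 ((-1 : ℝ) ^ (r + 1) / (2 * (r : ℝ) * π) * (gr - gl)))) ∧
    -- (b) its failure on `ΛBV \ HBV`
    (∀ lam : ℕ → ℝ, IsWatermanSeq lam → HBV ⊂ LambdaBV lam →
      ∃ g ∈ LambdaBV lam \ HBV, ∃ x₀ gl gr : ℝ,
        Tendsto g (𝓝[<] x₀) (𝓝 gl) ∧ Tendsto g (𝓝[>] x₀) (𝓝 gr) ∧
        (∃ R : ℕ → ℝ → ℝ, ∀ n, IsConjTail g n (R n)) ∧
        ∀ r : ℕ, 1 ≤ r → ∀ R : ℕ → ℝ → ℝ, (∀ n, IsConjTail g n (R n)) →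
          ¬ Tendsto (fun n : ℕ => (n : ℝ) ^ (2 * r) * iteratedPrimitive (2 * r) (R n) x₀) atTop
            (𝓝 ((-1 : ℝ) ^ (r + 1) / (2 * (r : ℝ) * π) * (gr - gl)))) := by

  refine ⟨fun g hg r hr x₀ => ?_, fun lam hlam hss => ?_⟩
  · obtain ⟨gl, hgl⟩ := exists_leftLimit isWatermanSeq_harmonic hg x₀
    obtain ⟨gr, hgr⟩ := exists_rightLimit isWatermanSeq_harmonic hg x₀
    exact ⟨gl, gr, hgl, hgr, exists_isConjTail_of_mem isWatermanSeq_harmonic hg,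
      fun R hR => tendsto_iteratedPrimitive_of_mem_HBV hg hgl hgr hr hR⟩
  · obtain ⟨g, hg, hunb⟩ := exists_unbounded_tails hlam hss.2
    obtain ⟨gl, hgl⟩ := exists_leftLimit hlam hg 0
    obtain ⟨gr, hgr⟩ := exists_rightLimit hlam hg 0
    obtain ⟨B, hB⟩ := exists_abs_le hlam hg
    have hm := aemeasurable_of_mem hlam hg
    -- No limit `L` whatsoever is possible. This gives the failure of the formula and also, with
    -- part (a) for `r = 1`, that `g` is not in `HBV`.
    have hfail : ∀ r : ℕ, 1 ≤ r → ∀ R : ℕ → ℝ → ℝ, (∀ n, IsConjTail g n (R n)) → ∀ L,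
        ¬ Tendsto (fun n : ℕ => (n : ℝ) ^ (2 * r) * iteratedPrimitive (2 * r) (R n) 0) atTop
          (𝓝 L) := by
      intro r hr R hR L hL
      obtain ⟨m, hbd⟩ := exists_abs_integral_tailKernel_le hg.1 hm hB hr hR hL
      obtain ⟨n, N, hn, hlt⟩ := hunb r hr m
      exact absurd (hbd n N hn) (not_le.2 hlt)
    have hex := exists_isConjTail_of_mem hlam hg
    refine ⟨g, ⟨hg, fun hH => ?_⟩, 0, gl, gr, hgl, hgr, hex, fun r hr R hR => hfail r hr R hR _⟩
    obtain ⟨R, hR⟩ := hex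
    exact hfail 1 le_rfl R hR _ (tendsto_iteratedPrimitive_of_mem_HBV hH hgl hgr le_rfl hR)
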